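/- **Setting.** Consider a planar color code on a triangle: take a connected three-valent cellulation of the sphere whose faces are properly colored with three colors (double edges are allowed), and remove one vertex together with its three edges and three faces. The remaining vertices are the physical qubits. Every remaining face carries one $X$-type and one $Z$-type stabilizer generator, each acting on all qubits of the face. Each of the three removed faces yields one boundary of the triangle, consisting of the qubits on that face. The logical operators $\overline X$ and $\overline Z$ are $X$ and $Z$ applied to all qubits. The code is an $[N,1,d]$ code if it has $N$ qubits, $N-1$ independent stabilizer generators and distance $d$. A logical Bell measurement (BM) is performed on two copies of the code, without photon loss, by a fixed physical BM on each of the $N$ pairs of corresponding qubits. Write eigenvalues $+1,-1$ as $0,1$. For $P\in\{X,Y,Z\}$ and $g\in\{0,1\}$, the $PP{=}g$ BM always yields the value of $PP$, identifies the physical Bell state completely if that value is $g$, and yields nothing more otherwise. The logical BM efficiency is the probability that the measurement outcomes identify the logical Bell state unambiguously, when the four logical Bell states are equally likely. **Theorem.** (i) Let an $[N,1,d]$ planar color code on a triangle be given. If one of its boundaries consists of $d$ qubits, then using $ZZ{=}1$ BMs on the $d$ qubit pairs of that boundary and $XX{=}1$ BMs on all other pairs gives a logical BM efficiency of exactly $1-2^{-d}$.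 In contrast, using the same $PP{=}g$ BM on all pairs (any $P\in\{X,Y,Z\}$, $g\in\{0,1\}$) gives a logical BM efficiency of at most $\frac12$. (ii) For $s\ge 1$ consider the triangular color code cut out of the 4-8-8 tiling as follows. The squares of the tiling correspond to the unit cells $(a,b)$ of a square grid and the octagons to the grid points; each square has four corners, one for each side of its cell, and each corner lies on the two octagons at the ends of that side. The qubits are all corners of the squares with $a,b\ge 0$, $a+b<s$, together with the western and southern corners of the squares with $a,b\ge 0$, $a+b=s$, except the southern corner of $(s,0)$. The faces are the squares $(a,b)$ with $a+b<s$ and the octagons $(x,y)$, restricted to the qubits present, with $x,y\ge 0$, $x+y\le s+1$ and $(x,y)\neq(s+1,0)$, except those with $y=0$, $x\equiv s \pmod 2$ and those with $x=0$, $y\not\equiv s\pmod 2$. The three boundaries are the qubits on an octagon of the first excluded kind, the qubits on an octagon of the second excluded kind, and the qubits with $a+b=s$. This code has $N=2s^2+4s+1$ qubits and encodes one logical qubit, and each of its three boundaries consists of $2s+1$ qubits. For each boundary, using $ZZ{=}1$ BMs on its qubit pairs and $XX{=}1$ BMs on all other pairs gives a logical BM efficiency of exactly $1-2^{-(2s+1)}$,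 whereas using the same $PP{=}g$ BM on all pairs gives at most $\frac12$. (iii) In particular, for each of the three boundaries, the efficiency of this formation on the 4-8-8 codes tends to $1$ as $s\to\infty$. -/

import Mathlib

open scoped Topology

open Classical in
/-- The cells of one colour: `orbitCell e a v` is the set of vertices that can be reached from `v`
along edges whose colour differs from `a`. -/
noncomputable def orbitCell {W : Type*} [Fintype W] (e : Fin 3 → Equiv.Perm W) (a : Fin 3) (v : W) :
    Finset W :=
  Finset.univ.filter fun w => ∃ g ∈ Subgroup.closure (e '' {b | b ≠ a}), g v = w

open Classical in
/-- The edges of colour `a`, as sets of two vertices. -/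
noncomputable def colorEdges {W : Type*} [Fintype W] (e : Fin 3 → Equiv.Perm W) (a : Fin 3) :
    Finset (Finset W) :=
  Finset.univ.image fun v => {v, e a v}

open Classical in
/-- The faces of colour `a`. -/
noncomputable def colorFaces {W : Type*} [Fintype W] (e : Fin 3 → Equiv.Perm W) (a : Fin 3) :
    Finset (Finset W) :=
  Finset.univ.image fun v => orbitCell e a v

/-- A three-valent cellulation of the sphere whose faces are properly coloured with three colours,
with vertex set `W`.  An edge gets the colour that neither of its two adjacent faces has, so that
every vertex has exactly one edge of each colour, `edge a v` is the other end of the edge of colour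
`a` at `v`, and the face of colour `a` at `v` is bounded by the edges of the other two colours.
The cellulation is connected and has the Euler characteristic `2` of the sphere. -/
structure ColoredSphere (W : Type*) [Fintype W] where
  edge : Fin 3 → Equiv.Perm W
  edge_edge : ∀ a v, edge a (edge a v) = v
  edge_ne : ∀ a v, edge a v ≠ v
  connected : ∀ v w, ∃ g ∈ Subgroup.closure (Set.range edge), g v = w
  euler : (Fintype.card W : ℤ) - ∑ a, ((colorEdges edge a).card : ℤ)
    + ∑ a, ((colorFaces edge a).card : ℤ) = 2

/-- A triangular planar cellulation of a planar colour code: a coloured sphere from which one vertex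
(the point at infinity), with its three edges and its three faces, is removed.  What remains is a
triangle in the plane; its corners are the former neighbours of the removed vertex. -/
structure TriangularCellulation (W : Type*) [Fintype W] extends ColoredSphere W where
  infinity : W

namespace TriangularCellulation

variable {W : Type*} [Fintype W] (T : TriangularCellulation W)

/-- The physical qubits: the vertices of the triangle. -/
abbrev Qubit : Type _ := {v : W // v ≠ T.infinity}

open Classical in
/-- The faces of the triangle, as sets of qubits. -/
noncomputable def faces : Set (Finset T.Qubit) :=
  {f | ∃ (a : Fin 3) (v : W), T.infinity ∉ orbitCell T.edge a v ∧
    f = Finset.univ.filter fun q : T.Qubit => q.1 ∈ orbitCell T.edge a v}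

open Classical in
/-- The three boundaries of the triangle: the qubits on the removed face of colour `a`. -/
noncomputable def boundary (a : Fin 3) : Finset T.Qubit :=
  Finset.univ.filter fun q : T.Qubit => q.1 ∈ orbitCell T.edge a T.infinity

end TriangularCellulation

/-- The four corners of a square of the 4-8-8 tiling. -/
inductive Corner
  | west
  | south
  | east
  | north
  deriving DecidableEq

instance : Fintype Corner :=
  ⟨{Corner.west, Corner.south, Corner.east, Corner.north}, fun c => by cases c <;> decide⟩

/-- In the 4-8-8 tiling the squares are labelled by the unit cells `(a, b)` of a square grid, the
octagons by the grid points.  The vertices of the tiling are the four corners of the squares; the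
corner on the west (south, ...) of the square `(a, b)` lies on the two octagons at the ends of the
west (south, ...) side of the cell. -/
def octagonsAt : ℕ × ℕ × Corner → Finset (ℕ × ℕ)
  | (a, b, Corner.west) => {(a, b), (a, b + 1)}
  | (a, b, Corner.south) => {(a, b), (a + 1, b)}
  | (a, b, Corner.east) => {(a + 1, b), (a + 1, b + 1)}
  | (a, b, Corner.north) => {(a, b + 1), (a + 1, b + 1)}

/-- The vertices of the triangle of size `s` in the 4-8-8 tiling: all corners of the squares with
`a + b < s`, and the western and southern corners on the diagonal `a + b = s`, except the
southern one of the last square. -/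
def vertices488 (s : ℕ) : Finset (ℕ × ℕ × Corner) :=
  (Finset.range (s + 1) ×ˢ Finset.range (s + 1) ×ˢ Finset.univ).filter fun q =>
    q.1 + q.2.1 < s ∨
      (q.1 + q.2.1 = s ∧ (q.2.2 = Corner.west ∨ (q.2.2 = Corner.south ∧ q.1 ≠ s)))

/-- The physical qubits of the triangular 4-8-8 colour code of size `s`. -/
abbrev Qubit488 (s : ℕ) : Type := {q : ℕ × ℕ × Corner // q ∈ vertices488 s}

/-- The octagons of one of the two octagon colours that are cut off at the bottom of the triangle
(the octagon colour is the parity of `x + y`). -/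
def CutBottom (s : ℕ) (p : ℕ × ℕ) : Prop := p.2 = 0 ∧ (p.1 + p.2) % 2 = s % 2

/-- The octagons of the other octagon colour that are cut off on the left of the triangle. -/
def CutLeft (s : ℕ) (p : ℕ × ℕ) : Prop := p.1 = 0 ∧ (p.1 + p.2) % 2 ≠ s % 2

open Classical in
/-- The set of qubits on the square `(a, b)`. -/
noncomputable def square488 (s a b : ℕ) : Finset (Qubit488 s) :=
  Finset.univ.filter fun q => q.1.1 = a ∧ q.1.2.1 = b

open Classical in
/-- The set of qubits on the (complete or truncated) octagon at the grid point `p`. -/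
noncomputable def octagon488 (s : ℕ) (p : ℕ × ℕ) : Finset (Qubit488 s) :=
  Finset.univ.filter fun q => p ∈ octagonsAt q.1

/-- The faces of the triangular 4-8-8 colour code of size `s`. -/
def faces488 (s : ℕ) : Set (Finset (Qubit488 s)) :=
  {f | (∃ a b, a + b < s ∧ f = square488 s a b) ∨
    ∃ p : ℕ × ℕ, p.1 + p.2 ≤ s + 1 ∧ p ≠ (s + 1, 0) ∧ ¬ CutBottom s p ∧ ¬ CutLeft s p ∧
      f = octagon488 s p}

open Classical in
/-- The three boundaries of the triangular 4-8-8 colour code of size `s`: each consists of the qubits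
that lie on no face of one of the three colours. -/
noncomputable def boundary488 (s : ℕ) : Fin 3 → Finset (Qubit488 s) :=
  ![Finset.univ.filter fun q => ∃ p ∈ octagonsAt q.1, CutBottom s p,
    Finset.univ.filter fun q => ∃ p ∈ octagonsAt q.1, CutLeft s p,
    Finset.univ.filter fun q => q.1.1 + q.1.2.1 = s]

open Classical in
/-- The indicator vector of a set of qubits. -/
noncomputable def indicatorVec {V : Type*} (f : Finset V) : V → ZMod 2 :=
  fun v => if v ∈ f then 1 else 0

/-- The supports of the `X`-type stabilizers of the colour code with the given faces; they are also
the supports of its `Z`-type stabilizers, since every face carries one generator of each type. -/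
def stabilizerSpace {V : Type*} (faces : Set (Finset V)) : Submodule (ZMod 2) (V → ZMod 2) :=
  Submodule.span (ZMod 2) (indicatorVec '' faces)

section Code

variable {V : Type*} [Fintype V]

/-- The binary vector `a` has even overlap with all stabilizer supports, that is, the Pauli operator
`X^a` (or `Z^a`) commutes with all stabilizers. -/
def CommutesWithStabilizers (faces : Set (Finset V)) (a : V → ZMod 2) : Prop :=
  ∀ g ∈ stabilizerSpace faces, ∑ v, a v * g v = 0

open Classical in
/-- The number of qubits on which the Pauli operator `X^a Z^b` acts non-trivially. -/
noncomputable def pauliWeight (a b : V → ZMod 2) : ℕ :=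
  (Finset.univ.filter fun v => a v ≠ 0 ∨ b v ≠ 0).card

/-- The Pauli operator `X^a Z^b` commutes with all stabilizers without being one (up to a phase). -/
def IsLogicalOperator (faces : Set (Finset V)) (a b : V → ZMod 2) : Prop :=
  CommutesWithStabilizers faces a ∧ CommutesWithStabilizers faces b ∧
    ¬ (a ∈ stabilizerSpace faces ∧ b ∈ stabilizerSpace faces)

/-- The code has `N` physical qubits and encodes `k` logical ones: there are `N - k` independent
stabilizer generators, counting both types. -/
def Encodes (faces : Set (Finset V)) (N k : ℕ) : Prop :=
  Fintype.card V = N ∧ Module.finrank (ZMod 2) (stabilizerSpace faces)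
    + Module.finrank (ZMod 2) (stabilizerSpace faces) + k = N

/-- `d` is the code distance, the least weight of a logical operator. -/
def IsDistance (faces : Set (Finset V)) (d : ℕ) : Prop :=
  IsLeast {w | ∃ a b : V → ZMod 2, IsLogicalOperator faces a b ∧ pauliWeight a b = w} d

/-- The sign `(-1)^t`. -/
def bitSign (t : ZMod 2) : ℂ := (-1) ^ t.val

/-- The Bell state with `XX`-eigenvalue `(-1)^x` and `ZZ`-eigenvalue `(-1)^z`, in coordinates: it is
`(|0,z⟩ + (-1)^x |1,1+z⟩) / √2`. -/
noncomputable def bell (x z : ZMod 2) (s t : ZMod 2) : ℂ :=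
  if t = s + z then bitSign (x * s) / (Real.sqrt 2 : ℂ) else 0

open Classical in
/-- The logical basis states.  `|0⟩` is the normalized sum of all `|g⟩` with `g` the support of an
`X`-type stabilizer, and `|1⟩` arises from it by applying `X` to all qubits. -/
noncomputable def logicalKet (faces : Set (Finset V)) (t : ZMod 2) (u : V → ZMod 2) : ℂ :=
  if (fun v => u v + t) ∈ stabilizerSpace faces then
    1 / (Real.sqrt (Nat.card (stabilizerSpace faces)) : ℂ) else 0

/-- The logical Bell states of two copies of the code, in the computational basis. -/
noncomputable def logicalBell (faces : Set (Finset V)) (c : ZMod 2 × ZMod 2)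
    (u w : V → ZMod 2) : ℂ :=
  ∑ s, ∑ t, bell c.1 c.2 s t * logicalKet faces s u * logicalKet faces t w

/-- The product, over all pairs of corresponding qubits of the two copies, of physical Bell states. -/
noncomputable def physicalBell (p : V → ZMod 2 × ZMod 2) (u w : V → ZMod 2) : ℂ :=
  ∏ v, bell (p v).1 (p v).2 (u v) (w v)

/-- The inner product of a product of physical Bell states with a logical Bell state. -/
noncomputable def amplitude [DecidableEq V] (faces : Set (Finset V)) (p : V → ZMod 2 × ZMod 2)
    (c : ZMod 2 × ZMod 2) : ℂ :=
  ∑ u : V → ZMod 2, ∑ w : V → ZMod 2,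
    (starRingEnd ℂ) (physicalBell p u w) * logicalBell faces c u w

end Code

/-- The three two-qubit operators `XX`, `YY`, `ZZ`. -/
inductive PauliPair
  | xx
  | yy
  | zz

/-- The eigenvalue of a two-qubit operator on a Bell state, `+1` being written as `0` and `-1` as `1`;
note that `YY = - XX ZZ`. -/
def PauliPair.value : PauliPair → ZMod 2 × ZMod 2 → ZMod 2
  | PauliPair.xx, c => c.1
  | PauliPair.yy, c => c.1 + c.2 + 1
  | PauliPair.zz, c => c.2

/-- The six static linear-optical Bell measurements without ancilla photons.  For instance, the
`ZZ=1` measurement is `⟨PauliPair.zz, 1⟩`: it always yields `ZZ`, and it identifies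
the Bell state if and only if the value of `ZZ` is `1` (eigenvalue `-1`). -/
structure BellMeasurement where
  guaranteed : PauliPair
  good : ZMod 2

/-- The outcome on a Bell state: the state itself if it is identified, and otherwise `none` (which
still tells that the guaranteed operator does not have the good value). -/
def BellMeasurement.outcome (m : BellMeasurement) (c : ZMod 2 × ZMod 2) :
    Option (ZMod 2 × ZMod 2) :=
  if m.guaranteed.value c = m.good then some c else none

section Efficiency

variable {V : Type*} [Fintype V] [DecidableEq V]

/-- The probability (Born rule) that the transversal measurement, with the Bell measurement `m v` on
the pair of qubits `v`, yields the outcomes `r` on the logical Bell state `c`. -/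
noncomputable def outcomeProb (faces : Set (Finset V)) (m : V → BellMeasurement)
    (r : V → Option (ZMod 2 × ZMod 2)) (c : ZMod 2 × ZMod 2) : ℝ :=
  ∑ p : V → ZMod 2 × ZMod 2,
    if (fun v => (m v).outcome (p v)) = r then ‖amplitude faces p c‖ ^ 2 else 0

/-- The outcomes `r` identify the logical Bell state unambiguously: at most one logical Bell state can
yield them. -/
def Identifies (faces : Set (Finset V)) (m : V → BellMeasurement)
    (r : V → Option (ZMod 2 × ZMod 2)) : Prop :=
  ∀ c c', outcomeProb faces m r c ≠ 0 → outcomeProb faces m r c' ≠ 0 → c = c'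

open Classical in
/-- The loss-free logical Bell-measurement efficiency: the probability that an equiprobably chosen
logical Bell state is identified. -/
noncomputable def efficiency (faces : Set (Finset V)) (m : V → BellMeasurement) : ℝ :=
  ∑ r : V → Option (ZMod 2 × ZMod 2),
    if Identifies faces m r then (∑ c, outcomeProb faces m r c) / 4 else 0

/-- The formation with `ZZ=1` measurements on `B` and `XX=1` measurements elsewhere. -/
def boundaryFormation (B : Finset V) : V → BellMeasurement :=
  fun v => if v ∈ B then ⟨PauliPair.zz, 1⟩ else ⟨PauliPair.xx, 1⟩

end Efficiency

/-!
Write `S` for the space of stabilizer supports and `L` for its orthogonal complement, and let `N` be the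
number of qubits. In both families of codes the faces are even and overlap evenly, so `S ≤ L`; there are
`(N - 1) / 2` independent faces, so `L` is the union of `S` and of its translate by the all-ones vector
(`IsOddSelfDual`). A product of physical Bell states with `XX`-values `a` and `ZZ`-values `b` then has
a non-zero amplitude in the logical Bell state `(x, z)` only if `a` and `b` lie in `L` and have parities
`x` and `z`, and the non-zero amplitudes all have the same modulus (`IsOddSelfDual.amplitude_eq`).
Hence the efficiency is the proportion of the pairs `(a, b)` in `L × L` whose parities are determined
by the outcomes (`IsOddSelfDual.efficiency_eq`).

For a uniform formation, let `t` be the indicator vector of the pairs of qubits on which the measurement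
fails. It lies in `L`, and if its parity is `1`, then applying the guaranteed operator, on one copy, to the
pairs in `t` changes the logical state but not the outcomes. Flipping the guaranteed value on all pairs
complements `t` and hence changes its parity, because `N` is odd; so at least half of all `(a, b)` are
not identified (`IsOddSelfDual.efficiency_uniform_le`).

For a boundary formation on `B`, suppose that the indicator vector of `B` is the only non-zero vector
of `L` supported on `B`, and that its parity is `1`. The `ZZ`-parity can be read off on `B`. The
`XX`-values are unknown only where `b` vanishes on `B`; if it does not vanish on all of `B`, the unknown
values support no non-zero vector of `L`, and if it does, adding the indicator vector of `B` to `a` is not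
noticed. The vectors of `L` restrict onto all vectors on `B`, since the relations between the coordinates
of `L` are the vectors of `S`; so `b` vanishes on `B` with probability `2 ^ (-|B|)`
(`IsOddSelfDual.efficiency_boundaryFormation`).

For a triangle cut out of a coloured sphere, evenness holds because two faces are both closed under the
edges of a colour that neither has, and the hypothesis on `B` holds because a boundary of minimal size cannot
contain a smaller logical operator. For the 4-8-8 codes, the faces are independent because they can be
eliminated one by one, starting from the diagonal (`linearIndependent_faceOf`), and the hypothesis on
`B` holds because `B` is a path whose consecutive qubits are all that some face contains of `B`
(`IsBoundaryPath`).
-/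

/-! ### Codes that are self-dual up to the all-ones vector -/

section SelfDual

variable {V : Type*} [Fintype V]

/-- The vectors with even overlap with all stabilizer supports: the orthogonal complement of the
stabilizer space, that is, the supports of the `X`-type operators commuting with the stabilizers. -/
def commutantSpace (faces : Set (Finset V)) : Submodule (ZMod 2) (V → ZMod 2) where
  carrier := {a | CommutesWithStabilizers faces a}
  add_mem' := by
    intro a b ha hb g hg
    simp [add_mul, Finset.sum_add_distrib, ha g hg, hb g hg]
  zero_mem' := by
    intro g _
    simp
  smul_mem' := by
    intro c a ha g hg
    have := ha g hg
    simp only [Pi.smul_apply, smul_eq_mul, mul_assoc, ← Finset.mul_sum, this, mul_zero]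

theorem sum_mul_indicatorVec [DecidableEq V] (a : V → ZMod 2) (f : Finset V) :
    ∑ v, a v * indicatorVec f v = ∑ v ∈ f, a v := by
  simp [indicatorVec, Finset.sum_ite_mem]

theorem commutes_iff_faces {faces : Set (Finset V)} {a : V → ZMod 2} :
    CommutesWithStabilizers faces a ↔ ∀ f ∈ faces, ∑ v ∈ f, a v = 0 := by
  classical
  constructor
  · intro h f hf
    rw [← sum_mul_indicatorVec]
    exact h _ (Submodule.subset_span ⟨f, hf, rfl⟩)
  · intro h g hg
    induction hg using Submodule.span_induction with
    | mem x hx =>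
      obtain ⟨f, hf, rfl⟩ := hx
      rw [sum_mul_indicatorVec]
      exact h f hf
    | zero => simp
    | add x y _ _ hx hy => simp [mul_add, Finset.sum_add_distrib, hx, hy]
    | smul c x _ hx =>
      simp only [Pi.smul_apply, smul_eq_mul, mul_left_comm, ← Finset.mul_sum, hx, mul_zero]

theorem finrank_commutantSpace (faces : Set (Finset V)) :
    Module.finrank (ZMod 2) (stabilizerSpace faces)
      + Module.finrank (ZMod 2) (commutantSpace faces) = Fintype.card V := by
  classical
  have h := Subspace.finrank_add_finrank_dualCoannihilator_eq
    ((stabilizerSpace faces).map (dotProductEquiv (ZMod 2) V).toLinearMap)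
  have h1 : ((stabilizerSpace faces).map
      (dotProductEquiv (ZMod 2) V).toLinearMap).dualCoannihilator = commutantSpace faces := by
    ext a
    simp only [Submodule.mem_dualCoannihilator, Submodule.mem_map, forall_exists_index, and_imp,
      forall_apply_eq_imp_iff₂]
    refine forall₂_congr fun g _ => ?_
    simp [dotProduct, mul_comm]
  rw [h1, LinearEquiv.finrank_map_eq] at h
  simpa using h

/-- The number `N` of qubits is odd, and the stabilizer space is self-orthogonal of the largest possible
dimension `(N - 1) / 2` and orthogonal to the all-ones vector, so that the commutant consists of the stabilizers and of their translates by the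
all-ones vector. -/
structure IsOddSelfDual (faces : Set (Finset V)) : Prop where
  card_eq_one : ∑ _v : V, (1 : ZMod 2) = 1
  two_mul_finrank : 2 * Module.finrank (ZMod 2) (commutantSpace faces) = Fintype.card V + 1
  add_mem_stabilizerSpace_iff : ∀ (a : V → ZMod 2) (t : ZMod 2),
    (fun v => a v + t) ∈ stabilizerSpace faces ↔ a ∈ commutantSpace faces ∧ ∑ v, a v = t

theorem zmod_two_cases (t : ZMod 2) : t = 0 ∨ t = 1 := by
  revert t; decide

/-- Self-orthogonality and a count of dimensions suffice. -/
theorem isOddSelfDual_of_even_overlaps [DecidableEq V] {faces : Set (Finset V)} {N : ℕ}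
    (henc : Encodes faces N 1) (heven : ∀ f ∈ faces, Even f.card)
    (hoverlap : ∀ f ∈ faces, ∀ g ∈ faces, Even (f ∩ g).card) : IsOddSelfDual faces := by
  let S := stabilizerSpace faces
  let L := commutantSpace faces
  obtain ⟨hcard, hrank⟩ := henc
  have hone : ∑ _v : V, (1 : ZMod 2) = 1 := by
    have h2 : Fintype.card V = 2 * Module.finrank (ZMod 2) (stabilizerSpace faces) + 1 := by omega
    have h3 : (2 : ZMod 2) = 0 := rfl
    simp [h2, h3]
  have hSL : S ≤ L := by
    refine Submodule.span_le.2 ?_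
    rintro _ ⟨f, hf, rfl⟩
    refine commutes_iff_faces.2 fun g hg => ?_
    have : ∑ v ∈ g, indicatorVec f v = ((f ∩ g).card : ZMod 2) := by
      rw [show f ∩ g = g.filter (· ∈ f) by ext; simp [and_comm]]
      rw [Finset.natCast_card_filter]
      exact Finset.sum_congr rfl fun v _ => by simp [indicatorVec]
    rw [this]
    exact (ZMod.natCast_eq_zero_iff_even).2 (hoverlap f hf g hg)
  have hsum : ∀ a ∈ S, ∑ v, a v = 0 := by
    intro a ha
    have h1 : CommutesWithStabilizers faces 1 := commutes_iff_faces.2 fun g hg => by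
      simpa using (ZMod.natCast_eq_zero_iff_even).2 (heven g hg)
    simpa using h1 a ha
  have hL1 : (1 : V → ZMod 2) ∈ L := commutes_iff_faces.2 fun g hg => by
    simpa using (ZMod.natCast_eq_zero_iff_even).2 (heven g hg)
  -- The sum functional on `L` has kernel `S`, by dimension.
  let σ : (V → ZMod 2) →ₗ[ZMod 2] ZMod 2 := ∑ v, LinearMap.proj v
  have hσ : ∀ a, σ a = ∑ v, a v := fun a => by simp [σ]
  let τ : L →ₗ[ZMod 2] ZMod 2 := σ.comp L.subtype
  have hsurj : LinearMap.range τ = ⊤ := by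
    rw [LinearMap.range_eq_top]
    intro t
    refine ⟨t • ⟨1, hL1⟩, ?_⟩
    rw [map_smul]
    have : τ ⟨1, hL1⟩ = 1 := by simp only [τ, LinearMap.comp_apply, hσ]; simpa using hone
    rw [this, smul_eq_mul, mul_one]
  have hker := τ.finrank_range_add_finrank_ker
  rw [hsurj, finrank_top, Module.finrank_self] at hker
  have hdim := finrank_commutantSpace faces
  have hmap : ∀ a, a ∈ L → ∑ v, a v = 0 → a ∈ (LinearMap.ker τ).map L.subtype := by
    intro a ha h0
    refine ⟨⟨a, ha⟩, ?_, rfl⟩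
    rw [SetLike.mem_coe, LinearMap.mem_ker, LinearMap.comp_apply, hσ]
    exact h0
  have heq : S = (LinearMap.ker τ).map L.subtype := by
    refine Submodule.eq_of_le_of_finrank_eq (fun a ha => hmap a (hSL ha) (hsum a ha)) ?_
    rw [LinearEquiv.finrank_eq (Submodule.equivMapOfInjective _ L.injective_subtype _).symm]
    simp only [S, L] at *
    omega
  have hmem : ∀ a, a ∈ L → ∑ v, a v = 0 → a ∈ S := fun a ha h0 => heq ▸ hmap a ha h0
  refine ⟨hone, by omega, fun a t => ?_⟩
  have hconst : ∀ t : ZMod 2, (fun _ : V => t) ∈ L := fun t => by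
    have h := L.smul_mem t hL1
    convert h using 1
    ext v; simp
  have hct : ∀ t : ZMod 2, ∑ _v : V, t = t := fun t => by
    have := congrArg (t * ·) hone
    simpa [Finset.mul_sum, mul_comm] using this
  have htt : ∀ t : ZMod 2, t + t = 0 := by decide
  constructor
  · intro h
    have h1 := L.add_mem (hSL h) (hconst t)
    have h2 := hsum _ h
    rw [Finset.sum_add_distrib, hct] at h2
    refine ⟨?_, ?_⟩
    · convert h1 using 1
      ext v; simp [add_assoc, htt]
    · have := congrArg (· + t) h2
      simpa [add_assoc, htt] using this
  · rintro ⟨h, rfl⟩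
    refine hmem _ (L.add_mem h (hconst _)) ?_
    change ∑ v, (a v + ∑ w, a w) = 0
    rw [Finset.sum_add_distrib, hct, htt]

namespace IsOddSelfDual

variable {faces : Set (Finset V)} (h : IsOddSelfDual faces)

include h

theorem mem_stabilizerSpace_iff (a : V → ZMod 2) :
    a ∈ stabilizerSpace faces ↔ a ∈ commutantSpace faces ∧ ∑ v, a v = 0 := by
  simpa using h.add_mem_stabilizerSpace_iff a 0

theorem const_mem (t : ZMod 2) : (fun _ => t) ∈ commutantSpace faces := by
  have h1 := ((h.add_mem_stabilizerSpace_iff (fun _ => t) t).1 (by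
    have : ∀ t : ZMod 2, t + t = 0 := by decide
    simp only [this]
    exact (stabilizerSpace faces).zero_mem)).1
  exact h1

theorem sum_const_eq (t : ZMod 2) : ∑ _v : V, t = t := by
  have := congrArg (t * ·) h.card_eq_one
  simpa [Finset.mul_sum, mul_comm] using this

/-- The double commutant of the code: a vector orthogonal to the commutant is a stabilizer. -/
theorem mem_stabilizerSpace_of_orthogonal {f : V → ZMod 2}
    (hf : ∀ a ∈ commutantSpace faces, ∑ v, f v * a v = 0) : f ∈ stabilizerSpace faces := by
  refine (h.mem_stabilizerSpace_iff f).2 ⟨fun g hg => hf g ((h.mem_stabilizerSpace_iff g).1 hg).1, ?_⟩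
  simpa using hf _ (h.const_mem 1)

end IsOddSelfDual

end SelfDual

/-! ### Amplitudes of products of physical Bell states -/

section Amplitude

theorem bitSign_add (s t : ZMod 2) : bitSign (s + t) = bitSign s * bitSign t := by
  rcases zmod_two_cases s with rfl | rfl <;> rcases zmod_two_cases t with rfl | rfl
  · simp [bitSign]
  · simp [bitSign]
  · simp [bitSign]
  · have h : (1 + 1 : ZMod 2) = 0 := rfl
    have h1 : (1 : ZMod 2).val = 1 := rfl
    simp [bitSign, h, h1]

theorem bitSign_zero : bitSign 0 = 1 := by simp [bitSign]

theorem bitSign_one : bitSign 1 = -1 := by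
  have h1 : (1 : ZMod 2).val = 1 := rfl
  simp [bitSign, h1]

theorem bitSign_sum {ι : Type*} (s : Finset ι) (f : ι → ZMod 2) :
    bitSign (∑ i ∈ s, f i) = ∏ i ∈ s, bitSign (f i) := by
  classical
  induction s using Finset.induction_on with
  | empty => simp [bitSign_zero]
  | insert i s hi ih => rw [Finset.sum_insert hi, Finset.prod_insert hi, bitSign_add, ih]

theorem star_bitSign (t : ZMod 2) : (starRingEnd ℂ) (bitSign t) = bitSign t := by
  simp [bitSign]

theorem sum_bitSign_mul (t : ZMod 2) : ∑ s, bitSign (s * t) = if t = 0 then 2 else 0 := by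
  have h : ∀ f : ZMod 2 → ℂ, ∑ s, f s = f 0 + f 1 := fun f => Fin.sum_univ_two f
  rw [h]
  rcases zmod_two_cases t with rfl | rfl
  · norm_num [bitSign_zero]
  · norm_num [bitSign_zero, bitSign_one]

theorem logicalBell_eq {V : Type*} (faces : Set (Finset V)) (c : ZMod 2 × ZMod 2) (u w : V → ZMod 2) :
    logicalBell faces c u w = ∑ s, bitSign (s * c.1) / (Real.sqrt 2 : ℂ) *
      (logicalKet faces s u * logicalKet faces (s + c.2) w) := by
  simp only [logicalBell, bell, ite_mul, zero_mul, Finset.sum_ite_eq', Finset.mem_univ, if_true]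
  refine Finset.sum_congr rfl fun s _ => ?_
  rw [mul_comm c.1, mul_assoc]

variable {V : Type*} [Fintype V]

theorem star_physicalBell (p : V → ZMod 2 × ZMod 2) (u w : V → ZMod 2) :
    (starRingEnd ℂ) (physicalBell p u w) = physicalBell p u w := by
  rw [physicalBell, map_prod]
  refine Finset.prod_congr rfl fun v _ => ?_
  unfold bell
  split_ifs
  · rw [map_div₀, star_bitSign, Complex.conj_ofReal]
  · simp

theorem physicalBell_eq [DecidableEq V] (p : V → ZMod 2 × ZMod 2) (u w : V → ZMod 2) :
    physicalBell p u w = if w = u + fun v => (p v).2 then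
      bitSign (∑ v, (p v).1 * u v) / (Real.sqrt 2 : ℂ) ^ Fintype.card V else 0 := by
  split_ifs with h
  · subst h
    simp [physicalBell, bell, bitSign_sum, Finset.prod_div_distrib]
  · obtain ⟨v, hv⟩ := Function.ne_iff.1 h
    refine Finset.prod_eq_zero (Finset.mem_univ v) ?_
    exact if_neg hv

open Classical in
/-- The product of two logical basis states, at arguments that differ by `b`. -/
theorem logicalKet_mul_logicalKet (faces : Set (Finset V)) (s z : ZMod 2) (u b : V → ZMod 2) :
    logicalKet faces s u * logicalKet faces (s + z) (u + b) =
      if (fun v => b v + z) ∈ stabilizerSpace faces then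
        (if (fun v => u v + s) ∈ stabilizerSpace faces then
          1 / (Nat.card (stabilizerSpace faces) : ℂ) else 0) else 0 := by
  have hadd : (fun v => (u + b) v + (s + z)) = (fun v => u v + s) + fun v => b v + z := by
    ext v; simp only [Pi.add_apply]; ring
  have hsq : (Real.sqrt (Nat.card (stabilizerSpace faces)) : ℂ)
      * (Real.sqrt (Nat.card (stabilizerSpace faces)) : ℂ)
        = (Nat.card (stabilizerSpace faces) : ℂ) := by
    rw [← Complex.ofReal_mul, Real.mul_self_sqrt (Nat.cast_nonneg _)]
    simp
  unfold logicalKet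
  by_cases hu : (fun v => u v + s) ∈ stabilizerSpace faces
  · rw [hadd, Submodule.add_mem_iff_right _ hu, if_pos hu]
    split_ifs
    · rw [div_mul_div_comm, hsq, one_mul]
    · simp
  · simp [hu]

open Classical in
/-- Orthogonality of characters on the coset of the stabilizer space by the vector `s, …, s`. -/
theorem sum_coset_bitSign [DecidableEq V] (faces : Set (Finset V)) (s : ZMod 2) (a : V → ZMod 2) :
    (∑ u : V → ZMod 2, if (fun v => u v + s) ∈ stabilizerSpace faces then
      bitSign (∑ v, a v * u v) else 0) = if a ∈ commutantSpace faces then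
        (Nat.card (stabilizerSpace faces) : ℂ) * bitSign (s * ∑ v, a v) else 0 := by
  have hss : ∀ s : ZMod 2, s + s = 0 := by decide
  -- translate the coset to the stabilizer space
  have h1 : (∑ u : V → ZMod 2, if (fun v => u v + s) ∈ stabilizerSpace faces then
      bitSign (∑ v, a v * u v) else 0) = bitSign (s * ∑ v, a v) * ∑ g : V → ZMod 2,
        if g ∈ stabilizerSpace faces then bitSign (∑ v, a v * g v) else 0 := by
    rw [← Equiv.sum_comp (Equiv.addRight (fun _ : V => s)), Finset.mul_sum]
    refine Finset.sum_congr rfl fun g _ => ?_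
    have h2 : (fun v => (Equiv.addRight (fun _ : V => s)) g v + s) = g := by
      ext v; simp [add_assoc, hss]
    rw [h2, mul_ite, mul_zero, ← bitSign_add]
    refine if_congr Iff.rfl (congrArg _ ?_) rfl
    simp [mul_add, Finset.sum_add_distrib, Finset.sum_mul, mul_comm s, add_comm]
  rw [h1]
  split_ifs with ha
  · have h3 : ∀ g : V → ZMod 2, (if g ∈ stabilizerSpace faces then
        bitSign (∑ v, a v * g v) else 0) = if g ∈ stabilizerSpace faces then (1 : ℂ) else 0 := by
      intro g
      split_ifs with hg
      · rw [ha g hg, bitSign_zero]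
      · rfl
    rw [Finset.sum_congr rfl fun g _ => h3 g, Finset.sum_boole, mul_comm,
      Nat.card_eq_fintype_card, Fintype.card_subtype]
  · -- a stabilizer that anticommutes gives a sign-reversing translation
    have : ∃ g₀ ∈ stabilizerSpace faces, ∑ v, a v * g₀ v = 1 := by
      by_contra hcon
      push Not at hcon
      exact ha fun g hg => (zmod_two_cases _).resolve_right (hcon g hg)
    obtain ⟨g₀, hg₀, h4⟩ := this
    set X := ∑ g : V → ZMod 2,
        if g ∈ stabilizerSpace faces then bitSign (∑ v, a v * g v) else 0 with hX
    have h5 : X = -X := by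
      conv_lhs => rw [hX, ← Equiv.sum_comp (Equiv.addRight g₀)]
      rw [hX, ← Finset.sum_neg_distrib]
      refine Finset.sum_congr rfl fun g _ => ?_
      simp only [Equiv.coe_addRight, Submodule.add_mem_iff_left _ hg₀, Pi.add_apply, mul_add,
        Finset.sum_add_distrib, bitSign_add, h4, bitSign_one]
      split_ifs <;> simp
    have h6 : X = 0 := by linear_combination h5 / 2
    rw [h6, mul_zero]

open Classical in
/-- The amplitude of a product of physical Bell states in a logical Bell state is non-zero only if the
`XX`- and the `ZZ`-values form commutant vectors whose parities are those of the logical state; its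
modulus is then constant. -/
theorem IsOddSelfDual.amplitude_eq {faces : Set (Finset V)} (h : IsOddSelfDual faces)
    [DecidableEq V] (p : V → ZMod 2 × ZMod 2) (c : ZMod 2 × ZMod 2) :
    amplitude faces p c =
      if ((fun v => (p v).1) ∈ commutantSpace faces ∧ (fun v => (p v).2) ∈ commutantSpace faces) ∧
        (∑ v, (p v).1 = c.1 ∧ ∑ v, (p v).2 = c.2) then
      (2 : ℂ) / (Real.sqrt 2 : ℂ) / (Real.sqrt 2 : ℂ) ^ Fintype.card V else 0 := by
  set r : ℂ := (Real.sqrt 2 : ℂ) with hr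
  have hK : (Nat.card (stabilizerSpace faces) : ℂ) ≠ 0 := by
    exact_mod_cast Nat.card_pos.ne'
  set b : V → ZMod 2 := fun v => (p v).2 with hb
  set a : V → ZMod 2 := fun v => (p v).1 with ha
  have h1 : amplitude faces p c = ∑ s, ∑ u : V → ZMod 2,
      bitSign (∑ v, a v * u v) / r ^ Fintype.card V * (bitSign (s * c.1) / r *
        (logicalKet faces s u * logicalKet faces (s + c.2) (u + b))) := by
    unfold amplitude
    rw [Finset.sum_comm (s := (Finset.univ : Finset (ZMod 2)))]
    refine Finset.sum_congr rfl fun u _ => ?_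
    simp only [star_physicalBell]
    simp only [physicalBell_eq, ite_mul, zero_mul, Finset.sum_ite_eq',
      Finset.mem_univ, if_true, logicalBell_eq]
    rw [Finset.mul_sum]
  rw [h1]
  by_cases hz : (fun v => b v + c.2) ∈ stabilizerSpace faces
  · have hz' := (h.add_mem_stabilizerSpace_iff b c.2).1 hz
    have h2 : ∀ s : ZMod 2, ∑ u : V → ZMod 2,
        bitSign (∑ v, a v * u v) / r ^ Fintype.card V * (bitSign (s * c.1) / r *
          (logicalKet faces s u * logicalKet faces (s + c.2) (u + b))) =
        bitSign (s * c.1) / r / r ^ Fintype.card V / (Nat.card (stabilizerSpace faces) : ℂ) *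
          ∑ u : V → ZMod 2, if (fun v => u v + s) ∈ stabilizerSpace faces then
            bitSign (∑ v, a v * u v) else 0 := by
      intro s
      rw [Finset.mul_sum]
      refine Finset.sum_congr rfl fun u _ => ?_
      rw [logicalKet_mul_logicalKet, if_pos hz]
      split_ifs
      · ring
      · simp
    rw [Finset.sum_congr rfl fun s _ => h2 s]
    simp only [sum_coset_bitSign]
    by_cases haL : a ∈ commutantSpace faces
    · have h3 : ∀ s : ZMod 2, bitSign (s * c.1) / r / r ^ Fintype.card V /
          (Nat.card (stabilizerSpace faces) : ℂ) *
          ((Nat.card (stabilizerSpace faces) : ℂ) * bitSign (s * ∑ v, a v)) =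
          bitSign (s * (c.1 + ∑ v, a v)) * (1 / r / r ^ Fintype.card V) := by
        intro s
        rw [mul_add, bitSign_add]
        field_simp
      simp only [haL, if_true]
      rw [Finset.sum_congr rfl fun s _ => h3 s, ← Finset.sum_mul, sum_bitSign_mul]
      have h4 : (c.1 + ∑ v, a v = 0) ↔ ∑ v, a v = c.1 := by
        have : ∀ x y : ZMod 2, x + y = 0 ↔ y = x := by decide
        exact this _ _
      simp only [h4, hz', and_true, true_and]
      split_ifs
      · ring
      · simp
    · simp [haL]
  · have hz' : ¬ (b ∈ commutantSpace faces ∧ ∑ v, b v = c.2) := fun h' =>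
      hz ((h.add_mem_stabilizerSpace_iff b c.2).2 h')
    rw [if_neg (fun h' => hz' ⟨h'.1.2, h'.2.2⟩)]
    refine Finset.sum_eq_zero fun s _ => Finset.sum_eq_zero fun u _ => ?_
    rw [logicalKet_mul_logicalKet, if_neg hz]
    simp

open Classical in
theorem IsOddSelfDual.norm_amplitude_sq {faces : Set (Finset V)} (h : IsOddSelfDual faces)
    [DecidableEq V] (p : V → ZMod 2 × ZMod 2) (c : ZMod 2 × ZMod 2) :
    ‖amplitude faces p c‖ ^ 2 =
      if ((fun v => (p v).1) ∈ commutantSpace faces ∧ (fun v => (p v).2) ∈ commutantSpace faces) ∧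
        (∑ v, (p v).1 = c.1 ∧ ∑ v, (p v).2 = c.2) then
      (2 : ℝ) / 2 ^ Fintype.card V else 0 := by
  rw [h.amplitude_eq]
  split_ifs
  · have h2 : Real.sqrt 2 ^ 2 = 2 := Real.sq_sqrt (by norm_num)
    rw [norm_div, norm_div, norm_pow, Complex.norm_real, Real.norm_of_nonneg (Real.sqrt_nonneg 2),
      Complex.norm_ofNat, div_pow, div_pow, ← pow_mul, mul_comm (Fintype.card V), pow_mul, h2]
    norm_num
  · simp

end Amplitude

/-! ### The efficiency as a proportion of pairs of commutant vectors -/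

section Counting

variable {V : Type*} [Fintype V] [DecidableEq V]

open Classical in
/-- The pairs of commutant vectors, written as the `XX`- and `ZZ`-values of physical Bell states.
These are the combinations of physical Bell states that occur in logical Bell states. -/
noncomputable def commutantPairs (faces : Set (Finset V)) : Finset (V → ZMod 2 × ZMod 2) :=
  Finset.univ.filter fun p =>
    (fun v => (p v).1) ∈ commutantSpace faces ∧ (fun v => (p v).2) ∈ commutantSpace faces

/-- The outcomes of the transversal measurement on a product of physical Bell states. -/
def outcomes (m : V → BellMeasurement) (p : V → ZMod 2 × ZMod 2) :
    V → Option (ZMod 2 × ZMod 2) := fun v => (m v).outcome (p v)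

/-- All combinations of physical Bell states compatible with the outcomes obtained from `p` belong to
the same logical Bell state, which is read off from the parities of the `XX`- and `ZZ`-values. -/
def IsDetermined (faces : Set (Finset V)) (m : V → BellMeasurement)
    (p : V → ZMod 2 × ZMod 2) : Prop :=
  ∀ p' ∈ commutantPairs faces, outcomes m p' = outcomes m p → ∑ v, p' v = ∑ v, p v

theorem mem_commutantPairs {faces : Set (Finset V)} {p : V → ZMod 2 × ZMod 2} :
    p ∈ commutantPairs faces ↔
      (fun v => (p v).1) ∈ commutantSpace faces ∧ (fun v => (p v).2) ∈ commutantSpace faces := by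
  simp [commutantPairs]

open Classical in
theorem card_commutantPairs_filter {faces : Set (Finset V)} (P : (V → ZMod 2) → Prop) :
    ((commutantPairs faces).filter fun p => P fun v => (p v).2).card =
      (Finset.univ.filter fun a => a ∈ commutantSpace faces).card *
        (Finset.univ.filter fun b => b ∈ commutantSpace faces ∧ P b).card := by
  rw [← Finset.card_product]
  refine Finset.card_nbij' (fun p => (fun v => (p v).1, fun v => (p v).2))
    (fun q v => (q.1 v, q.2 v)) ?_ ?_ ?_ ?_
  · intro p hp
    simp_all [mem_commutantPairs]
  · intro q hq
    simp_all [mem_commutantPairs]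
  · intro p _; rfl
  · intro q _; rfl

theorem add_smul_mem_commutantPairs {faces : Set (Finset V)} {p : V → ZMod 2 × ZMod 2}
    (hp : p ∈ commutantPairs faces) {t : V → ZMod 2} (ht : t ∈ commutantSpace faces) (δ : ZMod 2 × ZMod 2) :
    (fun v => p v + t v • δ) ∈ commutantPairs faces := by
  obtain ⟨ha, hb⟩ := mem_commutantPairs.1 hp
  refine mem_commutantPairs.2 ⟨?_, ?_⟩
  · have := (commutantSpace faces).add_mem ha ((commutantSpace faces).smul_mem δ.1 ht)
    convert this using 1
    ext v; simp [mul_comm]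
  · have := (commutantSpace faces).add_mem hb ((commutantSpace faces).smul_mem δ.2 ht)
    convert this using 1
    ext v; simp [mul_comm]

namespace IsOddSelfDual

variable {faces : Set (Finset V)} (h : IsOddSelfDual faces)

include h

theorem outcomeProb_eq (m : V → BellMeasurement) (r : V → Option (ZMod 2 × ZMod 2))
    (c : ZMod 2 × ZMod 2) :
    outcomeProb faces m r c = (2 : ℝ) / 2 ^ Fintype.card V *
      (((commutantPairs faces).filter fun p => outcomes m p = r ∧ ∑ v, p v = c).card : ℝ) := by
  classical
  rw [outcomeProb, Finset.natCast_card_filter, commutantPairs, Finset.sum_filter, Finset.mul_sum]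
  refine Finset.sum_congr rfl fun p _ => ?_
  have hc : ∑ v, p v = c ↔ ∑ v, (p v).1 = c.1 ∧ ∑ v, (p v).2 = c.2 := by
    rw [Prod.ext_iff, Prod.fst_sum, Prod.snd_sum]
  rw [h.norm_amplitude_sq]
  have ho : (fun v => (m v).outcome (p v)) = outcomes m p := rfl
  simp only [ho, hc]
  split_ifs <;> simp_all

theorem outcomeProb_ne_zero_iff (m : V → BellMeasurement) (r : V → Option (ZMod 2 × ZMod 2))
    (c : ZMod 2 × ZMod 2) :
    outcomeProb faces m r c ≠ 0 ↔
      ∃ p ∈ commutantPairs faces, outcomes m p = r ∧ ∑ v, p v = c := by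
  rw [h.outcomeProb_eq, mul_ne_zero_iff, Nat.cast_ne_zero, Finset.card_ne_zero,
    Finset.filter_nonempty_iff]
  exact and_iff_right (by positivity)

theorem identifies_outcomes_iff (m : V → BellMeasurement) {p : V → ZMod 2 × ZMod 2}
    (hp : p ∈ commutantPairs faces) :
    Identifies faces m (outcomes m p) ↔ IsDetermined faces m p := by
  simp only [Identifies, h.outcomeProb_ne_zero_iff]
  constructor
  · intro H p' hp' hout
    exact H _ _ ⟨p', hp', hout, rfl⟩ ⟨p, hp, rfl, rfl⟩
  · rintro H _ _ ⟨p₁, hp₁, h₁, rfl⟩ ⟨p₂, hp₂, h₂, rfl⟩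
    rw [H p₁ hp₁ h₁, H p₂ hp₂ h₂]

theorem sum_outcomeProb (m : V → BellMeasurement) (r : V → Option (ZMod 2 × ZMod 2)) :
    ∑ c, outcomeProb faces m r c = (2 : ℝ) / 2 ^ Fintype.card V *
      (((commutantPairs faces).filter fun p => outcomes m p = r).card : ℝ) := by
  simp only [h.outcomeProb_eq]
  rw [← Finset.mul_sum, ← Nat.cast_sum,
    Finset.card_eq_sum_card_fiberwise (f := fun p => ∑ v, p v) (t := Finset.univ) (by simp)]
  simp only [Finset.filter_filter]

open Classical in
theorem efficiency_eq (m : V → BellMeasurement) :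
    efficiency faces m = (((commutantPairs faces).filter fun p => IsDetermined faces m p).card : ℝ) /
      2 ^ (Fintype.card V + 1) := by
  have h1 : ((commutantPairs faces).filter fun p => IsDetermined faces m p).card =
      ∑ r : V → Option (ZMod 2 × ZMod 2), if Identifies faces m r then
        ((commutantPairs faces).filter fun p => outcomes m p = r).card else 0 := by
    rw [Finset.card_eq_sum_card_fiberwise (f := outcomes m) (t := Finset.univ) (by simp)]
    refine Finset.sum_congr rfl fun r _ => ?_
    rw [Finset.filter_filter]
    split_ifs with hr
    · congr 1
      refine Finset.filter_congr fun p hp => and_iff_right_of_imp ?_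
      rintro rfl
      exact (h.identifies_outcomes_iff m hp).1 hr
    · rw [Finset.card_eq_zero, Finset.filter_eq_empty_iff]
      rintro p hp ⟨hd, rfl⟩
      exact hr ((h.identifies_outcomes_iff m hp).2 hd)
  rw [efficiency, h1, Nat.cast_sum, Finset.sum_div]
  refine Finset.sum_congr rfl fun r _ => ?_
  split_ifs
  · rw [h.sum_outcomeProb, pow_succ]
    ring
  · simp

open Classical in
theorem card_commutantSpace_sq :
    (Finset.univ.filter fun a => a ∈ commutantSpace faces).card ^ 2 = 2 ^ (Fintype.card V + 1) := by
  have h1 : (Finset.univ.filter fun a => a ∈ commutantSpace faces).card =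
      2 ^ Module.finrank (ZMod 2) (commutantSpace faces) := by
    rw [← Fintype.card_subtype, Module.card_eq_pow_finrank (K := ZMod 2), ZMod.card]
  rw [h1, ← pow_mul, mul_comm, h.two_mul_finrank]

theorem card_commutantPairs : (commutantPairs faces).card = 2 ^ (Fintype.card V + 1) := by
  classical
  have h1 := card_commutantPairs_filter (faces := faces) fun _ => True
  simp only [Finset.filter_true, and_true, ← pow_two] at h1
  rw [h1, h.card_commutantSpace_sq]

end IsOddSelfDual

/-! ### Uniform formations -/

/-- The change of Bell state that leaves the value of the given operator fixed. -/
def PauliPair.preserving : PauliPair → ZMod 2 × ZMod 2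
  | PauliPair.xx => (0, 1)
  | PauliPair.yy => (1, 1)
  | PauliPair.zz => (1, 0)

/-- A change of Bell state that flips the value of the given operator. -/
def PauliPair.flipping : PauliPair → ZMod 2 × ZMod 2
  | PauliPair.xx => (1, 0)
  | PauliPair.yy => (1, 0)
  | PauliPair.zz => (0, 1)

theorem PauliPair.value_add_preserving (P : PauliPair) (c : ZMod 2 × ZMod 2) :
    P.value (c + P.preserving) = P.value c := by
  obtain ⟨x, z⟩ := c
  revert x z
  cases P <;> decide

theorem PauliPair.value_add_flipping (P : PauliPair) (c : ZMod 2 × ZMod 2) :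
    P.value (c + P.flipping) = P.value c + 1 := by
  obtain ⟨x, z⟩ := c
  revert x z
  cases P <;> decide

theorem PauliPair.preserving_ne_zero (P : PauliPair) : P.preserving ≠ 0 := by
  cases P <;> decide

namespace IsOddSelfDual

variable {faces : Set (Finset V)} (h : IsOddSelfDual faces)

include h

theorem value_mem (P : PauliPair) (g : ZMod 2) {p : V → ZMod 2 × ZMod 2}
    (hp : p ∈ commutantPairs faces) :
    (fun v => P.value (p v) + g) ∈ commutantSpace faces := by
  obtain ⟨ha, hb⟩ := mem_commutantPairs.1 hp
  refine (commutantSpace faces).add_mem ?_ (h.const_mem g)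
  cases P
  · exact ha
  · exact (commutantSpace faces).add_mem ((commutantSpace faces).add_mem ha hb) (h.const_mem 1)
  · exact hb

/-- If the pairs on which the measurement `m` fails form a logical operator, then multiplying by this
operator changes the logical Bell state without changing the outcomes. -/
theorem not_isDetermined_of_sum_eq_one (m : BellMeasurement) {p : V → ZMod 2 × ZMod 2}
    (hp : p ∈ commutantPairs faces)
    (hsum : ∑ v, (m.guaranteed.value (p v) + m.good) = 1) :
    ¬ IsDetermined faces (fun _ => m) p := by
  intro H
  set t : V → ZMod 2 := fun v => m.guaranteed.value (p v) + m.good with ht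
  have h1 := H _ (add_smul_mem_commutantPairs hp (h.value_mem m.guaranteed m.good hp)
      m.guaranteed.preserving) (by
    funext v
    simp only [outcomes, BellMeasurement.outcome]
    rcases zmod_two_cases (t v) with h0 | h0
    · have h0' : m.guaranteed.value (p v) + m.good = 0 := h0
      rw [h0', zero_smul, add_zero]
    · have h0' : m.guaranteed.value (p v) + m.good = 1 := h0
      have hne : m.guaranteed.value (p v) ≠ m.good := by
        intro h2
        rw [h2] at h0'
        have : ∀ g : ZMod 2, g + g ≠ 1 := by decide
        exact this _ h0'
      rw [h0', one_smul, PauliPair.value_add_preserving, if_neg hne, if_neg hne])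
  rw [Finset.sum_add_distrib, ← Finset.sum_smul, hsum, one_smul, add_eq_left] at h1
  exact m.guaranteed.preserving_ne_zero h1

/-- Flipping the guaranteed value on all pairs exchanges the two parities of the number of failures, and
one of the two does not identify the logical Bell state. -/
theorem efficiency_uniform_le (m : BellMeasurement) :
    efficiency faces (fun _ => m) ≤ 1 / 2 := by
  classical
  rw [h.efficiency_eq]
  set D := (commutantPairs faces).filter fun p => IsDetermined faces (fun _ => m) p with hD
  set U := (commutantPairs faces).filter fun p => ¬ IsDetermined faces (fun _ => m) p with hU
  have h1 : D.card + U.card = 2 ^ (Fintype.card V + 1) := by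
    rw [← h.card_commutantPairs]
    exact Finset.card_filter_add_card_filter_not _
  have h2 : D.card ≤ U.card := by
    refine Finset.card_le_card_of_injOn (fun p v => p v + m.guaranteed.flipping) ?_ ?_
    · intro p hp
      obtain ⟨hp, hd⟩ := Finset.mem_filter.1 hp
      have hp' : (fun v => p v + m.guaranteed.flipping) ∈ commutantPairs faces := by
        simpa using add_smul_mem_commutantPairs hp (h.const_mem 1) m.guaranteed.flipping
      refine Finset.mem_filter.2 ⟨hp', h.not_isDetermined_of_sum_eq_one m hp' ?_⟩
      have h3 : ∑ v, (m.guaranteed.value (p v) + m.good) = 0 :=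
        (zmod_two_cases _).resolve_right fun h3 => h.not_isDetermined_of_sum_eq_one m hp h3 hd
      simp only [PauliPair.value_add_flipping, add_right_comm _ (1 : ZMod 2)]
      rw [Finset.sum_add_distrib, h3, h.sum_const_eq, zero_add]
    · intro p _ q _ hpq
      funext v
      exact add_right_cancel (congrFun hpq v)
  have h3 : (D.card : ℝ) + U.card = 2 ^ (Fintype.card V + 1) := by exact_mod_cast h1
  have h4 : (D.card : ℝ) ≤ U.card := by exact_mod_cast h2
  rw [div_le_div_iff₀ (by positivity) (by norm_num)]
  linarith

/-! ### Boundary formations -/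

/-- With `1_B` the only non-zero commutant vector supported on `B`, the outcomes of the boundary
formation identify the logical Bell state if and only if some `ZZ`-value on `B` is `1`. -/
theorem isDetermined_boundaryFormation_iff {B : Finset V}
    (hB : indicatorVec B ∈ commutantSpace faces) (hodd : ∑ v, indicatorVec B v = 1)
    (hmin : ∀ f ∈ commutantSpace faces, (∀ v ∉ B, f v = 0) → f = 0 ∨ f = indicatorVec B)
    {p : V → ZMod 2 × ZMod 2} (hp : p ∈ commutantPairs faces) :
    IsDetermined faces (boundaryFormation B) p ↔ ¬ ∀ v ∈ B, (p v).2 = 0 := by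
  have hind : ∀ v, indicatorVec B v = if v ∈ B then 1 else 0 := fun v => by simp [indicatorVec]
  constructor
  · intro H h0
    have h1 := H _ (add_smul_mem_commutantPairs hp hB (1, 0)) (by
      funext v
      by_cases hv : v ∈ B
      · simp [outcomes, boundaryFormation, hv, BellMeasurement.outcome, PauliPair.value, h0 v hv]
      · simp [outcomes, boundaryFormation, hv, BellMeasurement.outcome, PauliPair.value, hind])
    rw [Finset.sum_add_distrib, ← Finset.sum_smul, hodd, one_smul, add_eq_left] at h1
    exact absurd h1 (by decide)
  · intro H p' hp' hout
    push Not at H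
    obtain ⟨w, hwB, hw⟩ := H
    obtain ⟨ha, hb⟩ := mem_commutantPairs.1 hp
    obtain ⟨ha', hb'⟩ := mem_commutantPairs.1 hp'
    have hda := (commutantSpace faces).add_mem ha' ha
    have hdb := (commutantSpace faces).add_mem hb' hb
    have htwo : ∀ x y : ZMod 2, x + y = 0 ↔ x = y := by decide
    have hin : ∀ c c' : ZMod 2 × ZMod 2,
        (if c'.2 = 1 then some c' else none) = (if c.2 = 1 then some c else none) →
          c'.2 = c.2 ∧ (c.2 ≠ 0 → c'.1 = c.1) := by decide
    have hex : ∀ c c' : ZMod 2 × ZMod 2,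
        (if c'.1 = 1 then some c' else none) = (if c.1 = 1 then some c else none) →
          c'.1 = c.1 := by decide
    have hoB : ∀ v ∈ B, (p' v).2 = (p v).2 ∧ ((p v).2 ≠ 0 → (p' v).1 = (p v).1) := fun v hv => by
      refine hin _ _ ?_
      simpa [outcomes, boundaryFormation, hv, BellMeasurement.outcome, PauliPair.value]
        using congrFun hout v
    have hoff : ∀ v ∉ B, (p' v).1 = (p v).1 := fun v hv => by
      refine hex _ _ ?_
      simpa [outcomes, boundaryFormation, hv, BellMeasurement.outcome, PauliPair.value]
        using congrFun hout v
    -- the `XX`-values differ by a vector on `B` that vanishes at `w`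
    have h1 : ∑ v, (p' v).1 = ∑ v, (p v).1 := by
      have h2 : ((fun v => (p' v).1) + fun v => (p v).1) = 0 := by
        refine (hmin _ hda fun v hv => (htwo _ _).2 (hoff v hv)).resolve_right fun h3 => ?_
        have h4 := congrFun h3 w
        rw [hind, if_pos hwB] at h4
        have h5 : (p' w).1 + (p w).1 = 0 := (htwo _ _).2 ((hoB w hwB).2 hw)
        exact absurd (h5.symm.trans h4) (by decide)
      exact Finset.sum_congr rfl fun v _ => (htwo _ _).1 (congrFun h2 v)
    -- the `ZZ`-values agree on `B`, and `1_B` differs from `1` by a stabilizer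
    have h2 : ∑ v, (p' v).2 = ∑ v, (p v).2 := by
      have h3 := hdb _ ((h.add_mem_stabilizerSpace_iff (indicatorVec B) 1).2 ⟨hB, hodd⟩)
      simp only [mul_add, mul_one, Finset.sum_add_distrib] at h3
      have h4 : ∑ v, ((fun v => (p' v).2) + fun v => (p v).2) v * indicatorVec B v = 0 := by
        refine Finset.sum_eq_zero fun v _ => ?_
        rw [hind]
        split_ifs with hv
        · rw [mul_one]
          exact (htwo _ _).2 (hoB v hv).1
        · rw [mul_zero]
      rw [h4, zero_add] at h3
      simp only [Pi.add_apply] at h3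
      rw [Finset.sum_add_distrib] at h3
      exact (htwo _ _).1 h3
    rw [Prod.ext_iff]
    simp only [Prod.fst_sum, Prod.snd_sum]
    exact ⟨h1, h2⟩

open Classical in
/-- The commutant restricts onto all vectors on `B`, since a relation between the coordinates in `B`
would be a stabilizer supported on `B`. -/
theorem card_vanishing_on {B : Finset V} (hodd : ∑ v, indicatorVec B v = 1)
    (hmin : ∀ f ∈ commutantSpace faces, (∀ v ∉ B, f v = 0) → f = 0 ∨ f = indicatorVec B) :
    2 ^ B.card * (Finset.univ.filter fun b => b ∈ commutantSpace faces ∧ ∀ v ∈ B, b v = 0).card =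
      (Finset.univ.filter fun b => b ∈ commutantSpace faces).card := by
  let L := commutantSpace faces
  let res : (V → ZMod 2) →ₗ[ZMod 2] (B → ZMod 2) := LinearMap.funLeft (ZMod 2) (ZMod 2) Subtype.val
  let ρ : L →ₗ[ZMod 2] (B → ZMod 2) := res.comp L.subtype
  have hρ : ∀ (b : L) (v : B), ρ b v = b.1 v := fun _ _ => rfl
  have hrange : LinearMap.range ρ = ⊤ := by
    by_contra hne
    obtain ⟨φ, hφ, hle⟩ := Submodule.exists_le_ker_of_lt_top _ (lt_top_iff_ne_top.2 hne)
    let f : V → ZMod 2 := fun v => if hv : v ∈ B then φ (Pi.single ⟨v, hv⟩ 1) else 0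
    have hφf : ∀ x : V → ZMod 2, φ (fun v : B => x v) = ∑ v, f v * x v := by
      intro x
      rw [← Finset.sum_subset (Finset.subset_univ B) (fun v _ hv => by simp [f, hv]),
        ← Finset.sum_coe_sort B, LinearMap.pi_apply_eq_sum_univ φ]
      refine Finset.sum_congr rfl fun v _ => ?_
      have : (fun j : B => if v = j then (1 : ZMod 2) else 0) = Pi.single v 1 := by
        ext j; simp [Pi.single_apply, eq_comm]
      rw [this]
      simp [f, mul_comm]
    have hfS : f ∈ stabilizerSpace faces := h.mem_stabilizerSpace_of_orthogonal fun a ha => by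
      rw [← hφf]
      exact hle ⟨⟨a, ha⟩, rfl⟩
    obtain ⟨hfL, hf0⟩ := (h.mem_stabilizerSpace_iff f).1 hfS
    rcases hmin f hfL (fun v hv => by simp [f, hv]) with h0 | h0
    · refine hφ (LinearMap.ext fun y => ?_)
      have := hφf fun v => if hv : v ∈ B then y ⟨v, hv⟩ else 0
      simpa [h0] using this
    · rw [h0, hodd] at hf0
      exact one_ne_zero hf0
  have hdim := ρ.finrank_range_add_finrank_ker
  rw [hrange, finrank_top, Module.finrank_pi, Fintype.card_coe] at hdim
  have hker : (Finset.univ.filter fun b => b ∈ commutantSpace faces ∧ ∀ v ∈ B, b v = 0).card =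
      Fintype.card (LinearMap.ker ρ) := by
    rw [← Fintype.card_subtype]
    refine Fintype.card_congr
      { toFun := fun b => ⟨⟨b.1, b.2.1⟩, by
          rw [LinearMap.mem_ker]; ext v; exact b.2.2 v.1 v.2⟩
        invFun := fun b => ⟨b.1.1, b.1.2, fun v hv => by
          have := congrFun (LinearMap.mem_ker.1 b.2) ⟨v, hv⟩
          exact this⟩
        left_inv := fun _ => rfl
        right_inv := fun _ => rfl }
  rw [hker, ← Fintype.card_subtype, Module.card_eq_pow_finrank (K := ZMod 2) (V := LinearMap.ker ρ),
    Module.card_eq_pow_finrank (K := ZMod 2) (V := commutantSpace faces), ZMod.card, ← pow_add, hdim]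

theorem efficiency_boundaryFormation {B : Finset V}
    (hB : indicatorVec B ∈ commutantSpace faces) (hodd : ∑ v, indicatorVec B v = 1)
    (hmin : ∀ f ∈ commutantSpace faces, (∀ v ∉ B, f v = 0) → f = 0 ∨ f = indicatorVec B) :
    efficiency faces (boundaryFormation B) = 1 - (1 / 2 : ℝ) ^ B.card := by
  classical
  rw [h.efficiency_eq, Finset.filter_congr fun p hp =>
    h.isDetermined_boundaryFormation_iff hB hodd hmin hp]
  have h1 := Finset.card_filter_add_card_filter_not (s := commutantPairs faces)
    fun p => ∀ v ∈ B, (p v).2 = 0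
  have hcount : ((commutantPairs faces).filter fun p => ∀ v ∈ B, (p v).2 = 0).card =
      (Finset.univ.filter fun a => a ∈ commutantSpace faces).card *
        (Finset.univ.filter fun b => b ∈ commutantSpace faces ∧ ∀ v ∈ B, b v = 0).card := by
    convert card_commutantPairs_filter (faces := faces) fun b => ∀ v ∈ B, b v = 0
  rw [h.card_commutantPairs, hcount] at h1
  have h2 := h.card_vanishing_on hodd hmin
  have h3 := h.card_commutantSpace_sq
  set l := (Finset.univ.filter fun b => b ∈ commutantSpace faces).card
  set k := (Finset.univ.filter fun b => b ∈ commutantSpace faces ∧ ∀ v ∈ B, b v = 0).card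
  have h1' := congrArg (Nat.cast : ℕ → ℝ) h1
  have h2' : (2 : ℝ) ^ B.card * k = l := by exact_mod_cast h2
  have h3' : (l : ℝ) ^ 2 = 2 ^ (Fintype.card V + 1) := by exact_mod_cast h3
  push_cast at h1'
  rw [eq_sub_of_add_eq' h1', ← h3', one_div, inv_pow]
  have hl : (l : ℝ) ≠ 0 := by
    intro h0
    rw [h0, zero_pow two_ne_zero] at h3'
    exact (by positivity : (0 : ℝ) ≠ 2 ^ (Fintype.card V + 1)) h3'
  rw [← h2'] at hl ⊢
  have hk : (k : ℝ) ≠ 0 := right_ne_zero_of_mul hl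
  field_simp

end IsOddSelfDual

end Counting

/-! ### Triangles cut out of coloured spheres -/

theorem even_card_of_involution {α : Type*} {A : Finset α} (σ : α → α)
    (hmem : ∀ a ∈ A, σ a ∈ A) (hinv : ∀ a ∈ A, σ (σ a) = a) (hne : ∀ a ∈ A, σ a ≠ a) :
    Even A.card := by
  rw [← ZMod.natCast_eq_zero_iff_even, Finset.card_eq_sum_ones, Nat.cast_sum]
  exact Finset.sum_involution (fun a _ => σ a) (fun _ _ => rfl) (fun a ha _ => hne a ha) hmem hinv

section Sphere

variable {W : Type*} [Fintype W]

theorem mem_orbitCell {e : Fin 3 → Equiv.Perm W} {a : Fin 3} {v w : W} :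
    w ∈ orbitCell e a v ↔ ∃ g ∈ Subgroup.closure (e '' {b | b ≠ a}), g v = w := by
  simp [orbitCell]

theorem self_mem_orbitCell (e : Fin 3 → Equiv.Perm W) (a : Fin 3) (v : W) : v ∈ orbitCell e a v :=
  mem_orbitCell.2 ⟨1, Subgroup.one_mem _, rfl⟩

theorem edge_mem_orbitCell {e : Fin 3 → Equiv.Perm W} {a b : Fin 3} (hb : b ≠ a) {v w : W}
    (hw : w ∈ orbitCell e a v) : e b w ∈ orbitCell e a v := by
  obtain ⟨g, hg, rfl⟩ := mem_orbitCell.1 hw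
  exact mem_orbitCell.2 ⟨e b * g,
    Subgroup.mul_mem _ (Subgroup.subset_closure ⟨b, hb, rfl⟩) hg, rfl⟩

namespace TriangularCellulation

variable [DecidableEq W] (T : TriangularCellulation W)

/-- Two faces are both closed under the edges of a colour that neither of them has. -/
theorem even_card_orbitCell_inter (a b : Fin 3) (v w : W) :
    Even (orbitCell T.edge a v ∩ orbitCell T.edge b w).card := by
  obtain ⟨c, hca, hcb⟩ : ∃ c, c ≠ a ∧ c ≠ b := by
    revert a b; decide
  refine even_card_of_involution (T.edge c) (fun x hx => ?_) (fun x _ => T.edge_edge c x)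
    fun x _ => T.edge_ne c x
  rw [Finset.mem_inter] at hx ⊢
  exact ⟨edge_mem_orbitCell hca hx.1, edge_mem_orbitCell hcb hx.2⟩

open Classical in
theorem card_qubits_mem (A : Finset W) :
    (Finset.univ.filter fun q : T.Qubit => q.1 ∈ A).card = (A.erase T.infinity).card := by
  refine Finset.card_bij (fun q _ => q.1) ?_ ?_ ?_
  · intro q hq
    exact Finset.mem_erase.2 ⟨q.2, (Finset.mem_filter.1 hq).2⟩
  · intro q _ q' _ h
    exact Subtype.ext h
  · intro v hv
    obtain ⟨h1, h2⟩ := Finset.mem_erase.1 hv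
    exact ⟨⟨v, h1⟩, by simpa using h2, rfl⟩

open Classical in
/-- A face of the triangle overlaps evenly with any face of the sphere, removed or not. -/
theorem even_card_face_inter {f : Finset T.Qubit} (hf : f ∈ T.faces) (b : Fin 3) (w : W) :
    Even (f ∩ Finset.univ.filter fun q : T.Qubit => q.1 ∈ orbitCell T.edge b w).card := by
  obtain ⟨a, v, hinf, hf⟩ := hf
  have h1 : (f ∩ Finset.univ.filter fun q : T.Qubit => q.1 ∈ orbitCell T.edge b w) =
      Finset.univ.filter fun q : T.Qubit => q.1 ∈ orbitCell T.edge a v ∩ orbitCell T.edge b w := by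
    ext q; simp [hf]
  rw [h1, card_qubits_mem, Finset.erase_eq_of_notMem fun h => hinf (Finset.mem_inter.1 h).1]
  convert T.even_card_orbitCell_inter a b v w

open Classical in
theorem boundary_eq (a : Fin 3) : T.boundary a =
    Finset.univ.filter fun q : T.Qubit => q.1 ∈ orbitCell T.edge a T.infinity := by
  ext q; simp [boundary]

theorem isOddSelfDual {N : ℕ} (henc : Encodes T.faces N 1) : IsOddSelfDual T.faces := by
  classical
  have h : ∀ f ∈ T.faces, ∀ g ∈ T.faces, Even (f ∩ g).card := by
    rintro f hf g ⟨b, w, _, rfl⟩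
    convert T.even_card_face_inter hf b w
  refine isOddSelfDual_of_even_overlaps henc (fun f hf => ?_) fun f hf g hg => ?_
  · simpa using h f hf f hf
  · convert h f hf g hg

theorem boundary_mem_commutantSpace (a : Fin 3) :
    indicatorVec (T.boundary a) ∈ commutantSpace T.faces := by
  classical
  refine commutes_iff_faces.2 fun f hf => ?_
  have h1 : ∑ v ∈ f, indicatorVec (T.boundary a) v = ((f ∩ T.boundary a).card : ZMod 2) := by
    rw [show f ∩ T.boundary a = f.filter (· ∈ T.boundary a) by ext; simp]
    rw [Finset.natCast_card_filter]
    exact Finset.sum_congr rfl fun v _ => by simp [indicatorVec]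
  rw [h1, ZMod.natCast_eq_zero_iff_even]
  rw [T.boundary_eq]
  convert T.even_card_face_inter hf a T.infinity

theorem sum_indicatorVec_boundary (a : Fin 3) : ∑ v, indicatorVec (T.boundary a) v = 1 := by
  classical
  have h1 : ∑ v, indicatorVec (T.boundary a) v = ((T.boundary a).card : ZMod 2) := by
    simp [indicatorVec]
  have h2 : (T.boundary a).card = ((orbitCell T.edge a T.infinity).erase T.infinity).card := by
    rw [← T.card_qubits_mem, T.boundary_eq]
  have h3 := T.even_card_orbitCell_inter a a T.infinity T.infinity
  rw [Finset.inter_self, ← Finset.card_erase_add_one (self_mem_orbitCell T.edge a T.infinity),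
    Nat.even_add_one, Nat.not_even_iff_odd] at h3
  rw [h1, h2, ZMod.natCast_eq_one_iff_odd]
  convert h3

end TriangularCellulation

end Sphere

/-- The indicator vector of a set whose size is the distance: a commutant vector supported on this set
would, by itself or added to the indicator vector, be a lighter logical operator. -/
theorem eq_zero_or_eq_indicatorVec_of_isDistance {V : Type*} [Fintype V] {faces : Set (Finset V)}
    (h : IsOddSelfDual faces) {B : Finset V} (hd : IsDistance faces B.card)
    (hB : indicatorVec B ∈ commutantSpace faces) (hodd : ∑ v, indicatorVec B v = 1) :
    ∀ f ∈ commutantSpace faces, (∀ v ∉ B, f v = 0) → f = 0 ∨ f = indicatorVec B := by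
  classical
  -- a commutant vector on `B` of odd parity has full support
  have key : ∀ f ∈ commutantSpace faces, (∀ v ∉ B, f v = 0) → ∑ v, f v = 1 →
      f = indicatorVec B := by
    intro f hf hsupp hsum
    have hlog : IsLogicalOperator faces f 0 := by
      refine ⟨hf, (commutantSpace faces).zero_mem, fun h' => ?_⟩
      have := ((h.mem_stabilizerSpace_iff f).1 h'.1).2
      rw [hsum] at this
      exact one_ne_zero this
    have hle : B.card ≤ pauliWeight f 0 := hd.2 ⟨f, 0, hlog, rfl⟩
    have hsub : (Finset.univ.filter fun v => f v ≠ 0 ∨ (0 : V → ZMod 2) v ≠ 0) ⊆ B := by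
      intro v hv
      by_contra hvB
      simp [hsupp v hvB] at hv
    have heq := Finset.eq_of_subset_of_card_le hsub (by
      refine hle.trans (le_of_eq ?_)
      unfold pauliWeight
      congr!)
    ext v
    by_cases hv : v ∈ B
    · have h1 := heq ▸ hv
      have h2 : f v ≠ 0 := by simpa using h1
      rw [(zmod_two_cases _).resolve_left h2]
      simp [indicatorVec, hv]
    · rw [hsupp v hv]
      simp [indicatorVec, hv]
  intro f hf hsupp
  rcases zmod_two_cases (∑ v, f v) with h0 | h1
  · left
    have h2 := key (f + indicatorVec B) ((commutantSpace faces).add_mem hf hB)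
      (fun v hv => by simp [hsupp v hv, indicatorVec, hv])
      (by simp only [Pi.add_apply]; rw [Finset.sum_add_distrib, h0, hodd, zero_add])
    exact add_eq_right.1 h2
  · exact Or.inr (key f hf hsupp h1)

theorem TriangularCellulation.efficiency_boundary {W : Type*} [Fintype W] [DecidableEq W]
    (T : TriangularCellulation W) {N d : ℕ} (henc : Encodes T.faces N 1)
    (hd : IsDistance T.faces d) (i : Fin 3) (hi : (T.boundary i).card = d) :
    efficiency T.faces (boundaryFormation (T.boundary i)) = 1 - (1 / 2 : ℝ) ^ d := by
  subst hi
  have h := T.isOddSelfDual henc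
  have hB := T.boundary_mem_commutantSpace i
  have hodd := T.sum_indicatorVec_boundary i
  exact h.efficiency_boundaryFormation hB hodd
    (eq_zero_or_eq_indicatorVec_of_isDistance h hd hB hodd)

/-! ### The triangular 4-8-8 codes: overlaps of faces -/

section Code488

variable {s : ℕ}

/-- The octagons that are faces of the triangle of size `s`. -/
def IsOctagonFace (s : ℕ) (p : ℕ × ℕ) : Prop :=
  p.1 + p.2 ≤ s + 1 ∧ p ≠ (s + 1, 0) ∧ ¬ CutBottom s p ∧ ¬ CutLeft s p

theorem mem_vertices488 {a b : ℕ} {c : Corner} : (a, b, c) ∈ vertices488 s ↔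
    a + b < s ∨ (a + b = s ∧ (c = Corner.west ∨ (c = Corner.south ∧ a ≠ s))) := by
  simp only [vertices488, Finset.mem_filter, Finset.mem_product, Finset.mem_range, Finset.mem_univ,
    and_true]
  constructor
  · exact fun h => h.2
  · intro h
    refine ⟨?_, h⟩
    omega

theorem mem_square488 {a b : ℕ} {q : Qubit488 s} :
    q ∈ square488 s a b ↔ q.1.1 = a ∧ q.1.2.1 = b := by
  simp [square488]

theorem mem_octagon488 {p : ℕ × ℕ} {q : Qubit488 s} :
    q ∈ octagon488 s p ↔ p ∈ octagonsAt q.1 := by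
  simp [octagon488]

/-- The other vertex of the same square that lies on the octagon `p`, for a vertex on this octagon.
On an octagon `p` with `p.1 + p.2 = s + 1`, the squares `(p.1 - 1, p.2)` and `(p.1, p.2 - 1)` of the
diagonal keep only one vertex each, and these two vertices are exchanged. -/
def swapAlongOctagon (s : ℕ) (p : ℕ × ℕ) : ℕ × ℕ × Corner → ℕ × ℕ × Corner
  | (a, b, Corner.west) => if a + b = s ∧ p = (a, b + 1) then (a - 1, b + 1, Corner.south) else
      if p = (a, b) then (a, b, Corner.south) else (a, b, Corner.north)
  | (a, b, Corner.south) => if a + b = s ∧ p = (a + 1, b) then (a + 1, b - 1, Corner.west) else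
      if p = (a, b) then (a, b, Corner.west) else (a, b, Corner.east)
  | (a, b, Corner.east) =>
      if p = (a + 1, b) then (a, b, Corner.south) else (a, b, Corner.north)
  | (a, b, Corner.north) =>
      if p = (a, b + 1) then (a, b, Corner.west) else (a, b, Corner.east)

/-- The other end of the edge between two octagons. -/
def acrossEdge : ℕ × ℕ × Corner → ℕ × ℕ × Corner
  | (a, b, Corner.west) => (a - 1, b, Corner.east)
  | (a, b, Corner.south) => (a, b - 1, Corner.north)
  | (a, b, Corner.east) => (a + 1, b, Corner.west)
  | (a, b, Corner.north) => (a, b + 1, Corner.south)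

theorem even_card_qubits (A : Finset (Qubit488 s)) (P : ℕ × ℕ × Corner → Prop)
    (hA : ∀ q, q ∈ A ↔ P q.1) (σ : ℕ × ℕ × Corner → ℕ × ℕ × Corner)
    (hσ : ∀ q ∈ vertices488 s, P q → σ q ∈ vertices488 s ∧ P (σ q) ∧ σ (σ q) = q ∧ σ q ≠ q) :
    Even A.card := by
  have h1 : A.card = (A.map (Function.Embedding.subtype _)).card := by simp
  rw [h1]
  have h2 : ∀ q, q ∈ A.map (Function.Embedding.subtype _) ↔ q ∈ vertices488 s ∧ P q := by
    intro q
    simpa [hA] using and_comm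
  refine even_card_of_involution σ (fun q hq => ?_) (fun q hq => ?_) fun q hq => ?_
  · have := hσ q ((h2 q).1 hq).1 ((h2 q).1 hq).2
    exact (h2 _).2 ⟨this.1, this.2.1⟩
  · exact (hσ q ((h2 q).1 hq).1 ((h2 q).1 hq).2).2.2.1
  · exact (hσ q ((h2 q).1 hq).1 ((h2 q).1 hq).2).2.2.2

theorem even_card_square_inter_octagon {a b : ℕ} (hab : a + b < s) (p : ℕ × ℕ) :
    Even (square488 s a b ∩ octagon488 s p).card := by
  refine even_card_qubits _ (fun q => (q.1 = a ∧ q.2.1 = b) ∧ p ∈ octagonsAt q)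
    (fun q => by rw [Finset.mem_inter, mem_square488, mem_octagon488]) (swapAlongOctagon s p) ?_
  obtain ⟨x, y⟩ := p
  rintro ⟨a', b', c⟩ - ⟨⟨h1, h2⟩, h3⟩
  simp only at h1 h2
  subst h1 h2
  cases c <;> simp only [octagonsAt, Finset.mem_insert, Finset.mem_singleton, Prod.mk.injEq] at h3 <;>
    rcases h3 with ⟨rfl, rfl⟩ | ⟨rfl, rfl⟩ <;>
    simp [swapAlongOctagon, octagonsAt, mem_vertices488, hab, hab.ne]

theorem even_card_square {a b : ℕ} (hab : a + b < s) : Even (square488 s a b).card := by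
  refine even_card_qubits _ (fun q => q.1 = a ∧ q.2.1 = b) (fun q => mem_square488)
    (fun q => (q.1, q.2.1, match q.2.2 with
      | Corner.west => Corner.south
      | Corner.south => Corner.west
      | Corner.east => Corner.north
      | Corner.north => Corner.east)) ?_
  rintro ⟨a', b', c⟩ - ⟨h1, h2⟩
  simp only at h1 h2
  subst h1 h2
  cases c <;> simp [mem_vertices488, hab]

theorem even_card_octagon {p : ℕ × ℕ} (hp : IsOctagonFace s p) : Even (octagon488 s p).card := by
  refine even_card_qubits _ (fun q => p ∈ octagonsAt q) (fun q => mem_octagon488)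
    (swapAlongOctagon s p) ?_
  obtain ⟨x, y⟩ := p
  obtain ⟨h1, h2, h3, h4⟩ := hp
  simp only [CutBottom, CutLeft, ne_eq, Prod.mk.injEq] at h1 h2 h3 h4
  rintro ⟨a, b, c⟩ hq h5
  rw [mem_vertices488] at hq
  rcases hq with hab | ⟨rfl, hc⟩
  · cases c <;>
      simp only [octagonsAt, Finset.mem_insert, Finset.mem_singleton, Prod.mk.injEq] at h5 <;>
      rcases h5 with ⟨rfl, rfl⟩ | ⟨rfl, rfl⟩ <;>
      simp [swapAlongOctagon, octagonsAt, mem_vertices488, hab, hab.ne]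
  · rcases hc with rfl | ⟨rfl, hc⟩ <;>
      simp only [octagonsAt, Finset.mem_insert, Finset.mem_singleton, Prod.mk.injEq] at h5 <;>
      rcases h5 with ⟨rfl, rfl⟩ | ⟨rfl, rfl⟩
    · have : y ≠ 0 := by omega
      simp [swapAlongOctagon, octagonsAt, mem_vertices488, this]
    · obtain ⟨a, rfl⟩ : ∃ a', x = a' + 1 := ⟨x - 1, by omega⟩
      simp [swapAlongOctagon, octagonsAt, mem_vertices488]
      omega
    · simp [swapAlongOctagon, octagonsAt, mem_vertices488]
    · obtain ⟨b, rfl⟩ : ∃ b', y = b' + 1 := ⟨y - 1, by omega⟩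
      simp [swapAlongOctagon, octagonsAt, mem_vertices488]
      omega

theorem even_card_octagon_inter {p p' : ℕ × ℕ} (hne : p ≠ p') (hp : IsOctagonFace s p)
    (hp' : IsOctagonFace s p') : Even (octagon488 s p ∩ octagon488 s p').card := by
  refine even_card_qubits _ (fun q => p ∈ octagonsAt q ∧ p' ∈ octagonsAt q)
    (fun q => by rw [Finset.mem_inter, mem_octagon488, mem_octagon488]) acrossEdge ?_
  obtain ⟨x, y⟩ := p
  obtain ⟨x', y'⟩ := p'
  obtain ⟨h1, h2, h3, h4⟩ := hp
  obtain ⟨h1', h2', h3', h4'⟩ := hp'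
  simp only [CutBottom, CutLeft, ne_eq, Prod.mk.injEq] at *
  rintro ⟨a, b, c⟩ hq h5
  rw [mem_vertices488] at hq
  cases c <;> simp only [acrossEdge, octagonsAt, mem_vertices488, Finset.mem_insert,
      Finset.mem_singleton, Prod.mk.injEq, ne_eq, reduceCtorEq, true_and, false_and, or_false,
      and_false, and_true, false_or, not_false_eq_true] at h5 hq ⊢ <;>
    omega

end Code488

/-! ### The triangular 4-8-8 codes: independence and number of the faces -/

/-- A triangular system of vectors is linearly independent: `q i` is a coordinate at which `v i` is
`1`, and the other vectors that do not vanish there have smaller rank. -/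
theorem linearIndependent_of_triangular {ι V : Type*} [Fintype ι] (v : ι → V → ZMod 2)
    (q : ι → V) (rank : ι → ℕ) (h1 : ∀ i, v i (q i) = 1)
    (h2 : ∀ i j, j ≠ i → v j (q i) ≠ 0 → rank j < rank i) : LinearIndependent (ZMod 2) v := by
  classical
  rw [Fintype.linearIndependent_iff]
  intro g hg
  have key : ∀ n i, rank i = n → g i = 0 := by
    intro n
    induction n using Nat.strong_induction_on with
    | _ n ih =>
      rintro i rfl
      have h3 := congrFun hg (q i)
      rw [Finset.sum_apply, Finset.sum_eq_single i] at h3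
      · simpa [h1] using h3
      · intro j _ hj
        by_cases h0 : v j (q i) = 0
        · simp [h0]
        · simp [ih _ (h2 i j hj h0) j rfl]
      · simp
  exact fun i => key _ i rfl

section Code488

variable {s : ℕ}

/-- The cells strictly below the diagonal, which are the squares of the triangle of size `s`. -/
def triangleCells (s : ℕ) : Finset (ℕ × ℕ) :=
  (Finset.range s ×ˢ Finset.range s).filter fun p => p.1 + p.2 < s

theorem mem_triangleCells {p : ℕ × ℕ} : p ∈ triangleCells s ↔ p.1 + p.2 < s := by
  simp only [triangleCells, Finset.mem_filter, Finset.mem_product, Finset.mem_range]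
  omega

theorem two_mul_card_triangleCells (s : ℕ) : 2 * (triangleCells s).card = s * (s + 1) := by
  induction s with
  | zero => rfl
  | succ s ih =>
    have h1 : triangleCells (s + 1) =
        triangleCells s ∪ (Finset.range (s + 1)).image fun k => (k, s - k) := by
      ext ⟨a, b⟩
      simp only [mem_triangleCells, Finset.mem_union, Finset.mem_image, Finset.mem_range,
        Prod.mk.injEq]
      constructor
      · intro h
        by_cases h' : a + b < s
        · exact Or.inl h'
        · exact Or.inr ⟨a, by omega, rfl, by omega⟩
      · rintro (h | ⟨k, h, rfl, rfl⟩) <;> omega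
    rw [h1, Finset.card_union_of_disjoint, Finset.card_image_of_injective, Finset.card_range]
    · linarith
    · intro k k' h
      exact (Prod.mk.inj h).1
    · rw [Finset.disjoint_left]
      rintro ⟨a, b⟩ h h'
      simp only [mem_triangleCells, Finset.mem_image, Finset.mem_range, Prod.mk.injEq] at h h'
      obtain ⟨k, h, rfl, rfl⟩ := h'
      omega

theorem card_vertices488 (s : ℕ) :
    (vertices488 s).card = 4 * (triangleCells s).card + (2 * s + 1) := by
  have h1 : vertices488 s =
      ((triangleCells s ×ˢ (Finset.univ : Finset Corner)).image fun q => (q.1.1, q.1.2, q.2)) ∪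
        (((Finset.range (s + 1)).image fun k => (k, s - k, Corner.west)) ∪
          (Finset.range s).image fun k => (k, s - k, Corner.south)) := by
    ext ⟨a, b, c⟩
    simp only [mem_vertices488, Finset.mem_union, Finset.mem_image, Finset.mem_range,
      Finset.mem_product, mem_triangleCells, Finset.mem_univ, and_true, Prod.mk.injEq, Prod.exists]
    constructor
    · rintro (h | ⟨h, rfl | ⟨rfl, h'⟩⟩)
      · exact Or.inl ⟨a, b, c, h, rfl, rfl, rfl⟩
      · exact Or.inr (Or.inl ⟨a, by omega, rfl, by omega, rfl⟩)
      · exact Or.inr (Or.inr ⟨a, by omega, rfl, by omega, rfl⟩)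
    · rintro (⟨a, b, c, h, rfl, rfl, rfl⟩ | ⟨k, h, rfl, rfl, rfl⟩ | ⟨k, h, rfl, rfl, rfl⟩)
      · exact Or.inl h
      · exact Or.inr ⟨by omega, Or.inl rfl⟩
      · exact Or.inr ⟨by omega, Or.inr ⟨rfl, by omega⟩⟩
  rw [h1, Finset.card_union_of_disjoint, Finset.card_union_of_disjoint,
    Finset.card_image_of_injective, Finset.card_image_of_injective, Finset.card_image_of_injective,
    Finset.card_product, Finset.card_range, Finset.card_range,
    show (Finset.univ : Finset Corner).card = 4 from rfl]
  · ring
  · intro k k' h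
    exact (Prod.mk.inj h).1
  · intro k k' h
    exact (Prod.mk.inj h).1
  · rintro ⟨⟨a, b⟩, c⟩ ⟨⟨a', b'⟩, c'⟩ h
    simp only [Prod.mk.injEq] at h ⊢
    tauto
  · rw [Finset.disjoint_left]
    rintro ⟨a, b, c⟩ h h'
    simp only [Finset.mem_image, Prod.mk.injEq] at h h'
    obtain ⟨_, _, _, _, rfl⟩ := h
    obtain ⟨_, _, _, _, h''⟩ := h'
    cases h''
  · rw [Finset.disjoint_left]
    rintro ⟨a, b, c⟩ h h'
    simp only [Finset.mem_union, Finset.mem_image, Finset.mem_range,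
      Finset.mem_product, mem_triangleCells, Finset.mem_univ, and_true, Prod.mk.injEq,
      Prod.exists] at h h'
    obtain ⟨a, b, c, h, rfl, rfl, rfl⟩ := h
    rcases h' with ⟨k, h', rfl, rfl, rfl⟩ | ⟨k, h', rfl, rfl, rfl⟩ <;> omega

open Classical in
/-- The labels of the octagons of the triangle of size `s`. -/
noncomputable def octagonLabels (s : ℕ) : Finset (ℕ × ℕ) :=
  (Finset.range (s + 2) ×ˢ Finset.range (s + 2)).filter fun p => IsOctagonFace s p

theorem mem_octagonLabels {p : ℕ × ℕ} : p ∈ octagonLabels s ↔ IsOctagonFace s p := by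
  simp only [octagonLabels, Finset.mem_filter, Finset.mem_product, Finset.mem_range,
    and_iff_right_iff_imp]
  intro h
  have := h.1
  omega

/-- Away from the axes, the octagons correspond to the squares; on the axes there is one octagon at each
distance `1, …, s` from the origin. -/
theorem card_octagonLabels (s : ℕ) :
    (octagonLabels s).card = (triangleCells s).card + s := by
  have h1 : octagonLabels s = ((triangleCells s).image fun p => (p.1 + 1, p.2 + 1)) ∪
      (Finset.range s).image fun k => if (k + 1) % 2 = s % 2 then (0, k + 1) else (k + 1, 0) := by
    ext ⟨x, y⟩
    simp only [mem_octagonLabels, IsOctagonFace, CutBottom, CutLeft, Finset.mem_union,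
      Finset.mem_image, Finset.mem_range, mem_triangleCells, ne_eq, Prod.mk.injEq, Prod.exists]
    constructor
    · intro h
      rcases x with _ | x
      · refine Or.inr ⟨y - 1, by omega, ?_⟩
        rw [if_pos (by omega)]
        ext <;> simp
        omega
      · rcases y with _ | y
        · refine Or.inr ⟨x, by omega, ?_⟩
          rw [if_neg (by omega)]
        · exact Or.inl ⟨x, y, by omega, rfl, rfl⟩
    · rintro (⟨a, b, h, rfl, rfl⟩ | ⟨k, h, h'⟩)
      · omega
      · split_ifs at h' <;> simp only [Prod.mk.injEq] at h' <;> omega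
  rw [h1, Finset.card_union_of_disjoint, Finset.card_image_of_injective,
    Finset.card_image_of_injective, Finset.card_range]
  · intro k k' h
    simp only at h
    split_ifs at h <;> simp only [Prod.mk.injEq] at h <;> omega
  · rintro ⟨a, b⟩ ⟨a', b'⟩ h
    simp only [Prod.mk.injEq, add_left_inj] at h ⊢
    exact h
  · rw [Finset.disjoint_left]
    rintro ⟨x, y⟩ h h'
    simp only [Finset.mem_image, Prod.mk.injEq, Prod.exists] at h h'
    obtain ⟨a, b, _, rfl, rfl⟩ := h
    obtain ⟨k, _, h'⟩ := h'
    split_ifs at h' <;> simp at h'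

/-- The labels of all faces: squares on the left, octagons on the right. -/
abbrev FaceLabel (s : ℕ) : Type := {p // p ∈ (triangleCells s).disjSum (octagonLabels s)}

/-- The face with a given label. -/
noncomputable def faceOf (i : FaceLabel s) : Finset (Qubit488 s) :=
  Sum.elim (fun p => square488 s p.1 p.2) (octagon488 s) i.1

theorem range_faceOf : Set.range (faceOf (s := s)) = faces488 s := by
  ext f
  constructor
  · rintro ⟨⟨p | p, hp⟩, rfl⟩
    · exact Or.inl ⟨p.1, p.2, mem_triangleCells.1 (by simpa using hp), rfl⟩
    · obtain ⟨h1, h2, h3, h4⟩ : IsOctagonFace s p := mem_octagonLabels.1 (by simpa using hp)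
      exact Or.inr ⟨p, h1, h2, h3, h4, rfl⟩
  · rintro (⟨a, b, h, rfl⟩ | ⟨p, h1, h2, h3, h4, rfl⟩)
    · exact ⟨⟨Sum.inl (a, b), by simpa using mem_triangleCells.2 h⟩, rfl⟩
    · exact ⟨⟨Sum.inr p, by simpa using mem_octagonLabels.2 ⟨h1, h2, h3, h4⟩⟩, rfl⟩

/-- The qubit on which a face is tested: the northern corner of a square, and on an octagon a
vertex whose other octagon has smaller `eliminationRank`. -/
def pivotVertex (s : ℕ) : (ℕ × ℕ) ⊕ (ℕ × ℕ) → ℕ × ℕ × Corner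
  | Sum.inl (a, b) => (a, b, Corner.north)
  | Sum.inr (x, y) => if x + y ≤ s then (x, y, Corner.south) else (x, y - 1, Corner.west)

/-- The order in which the faces are eliminated: from the diagonal to the origin, and along the diagonal
itself from its lower end upwards. -/
def eliminationRank (s : ℕ) : (ℕ × ℕ) ⊕ (ℕ × ℕ) → ℕ
  | Sum.inl (a, b) => 2 * s + 4 + 2 * (s - (a + b))
  | Sum.inr (x, y) => if x + y = s + 1 then 2 * y else
      if x + y = s then 2 * y + 1 else 2 * s + 5 + 2 * (s - (x + y))

theorem pivotVertex_mem (i : FaceLabel s) : pivotVertex s i.1 ∈ vertices488 s := by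
  obtain ⟨⟨a, b⟩ | ⟨x, y⟩, hp⟩ := i
  · have h := mem_triangleCells.1 (by simpa using hp : (a, b) ∈ triangleCells s)
    exact mem_vertices488.2 (Or.inl h)
  · have h := mem_octagonLabels.1 (by simpa using hp : (x, y) ∈ octagonLabels s)
    simp only [IsOctagonFace, CutBottom, CutLeft, ne_eq, Prod.mk.injEq] at h
    simp only [pivotVertex]
    split_ifs <;> simp [mem_vertices488] <;> omega

theorem linearIndependent_faceOf :
    LinearIndependent (ZMod 2) fun i : FaceLabel s => indicatorVec (faceOf i) := by
  refine linearIndependent_of_triangular _ (fun i => ⟨pivotVertex s i.1, pivotVertex_mem i⟩)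
    (fun i => eliminationRank s i.1) ?_ ?_
  · intro i
    simp only [indicatorVec, ite_eq_left_iff]
    intro h
    refine absurd ?_ h
    obtain ⟨⟨a, b⟩ | ⟨x, y⟩, hp⟩ := i
    · exact mem_square488.2 ⟨rfl, rfl⟩
    · have h := mem_octagonLabels.1 (by simpa using hp : (x, y) ∈ octagonLabels s)
      simp only [IsOctagonFace, CutBottom, CutLeft, ne_eq, Prod.mk.injEq] at h
      refine mem_octagon488.2 ?_
      simp only [pivotVertex]
      split_ifs
      · simp [octagonsAt]
      · simp only [octagonsAt, Finset.mem_insert, Finset.mem_singleton, Prod.mk.injEq,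
          true_and]
        omega
  · intro i j hne hmem
    have hmem' : (⟨pivotVertex s i.1, pivotVertex_mem i⟩ : Qubit488 s) ∈ faceOf j := by
      by_contra h
      simp [indicatorVec, h] at hmem
    have hne' : j.1 ≠ i.1 := fun h => hne (Subtype.ext h)
    clear hmem hne
    obtain ⟨⟨a, b⟩ | ⟨x, y⟩, hp⟩ := i <;> obtain ⟨⟨a', b'⟩ | ⟨x', y'⟩, hp'⟩ := j
    · have h := mem_square488.1 hmem'
      simp only [pivotVertex] at h
      simp only [ne_eq, Sum.inl.injEq, Prod.mk.injEq] at hne'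
      omega
    · have h := mem_octagon488.1 hmem'
      have h1 := mem_triangleCells.1 (by simpa using hp : (a, b) ∈ triangleCells s)
      have h2 := mem_octagonLabels.1 (by simpa using hp' : (x', y') ∈ octagonLabels s)
      simp only [IsOctagonFace, CutBottom, CutLeft, ne_eq, Prod.mk.injEq] at h1 h2
      simp only [pivotVertex, octagonsAt, Finset.mem_insert, Finset.mem_singleton,
        Prod.mk.injEq] at h
      simp only [eliminationRank]
      split_ifs <;> omega
    · have h := mem_square488.1 hmem'
      have h1 := mem_triangleCells.1 (by simpa using hp' : (a', b') ∈ triangleCells s)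
      have h2 := mem_octagonLabels.1 (by simpa using hp : (x, y) ∈ octagonLabels s)
      simp only [IsOctagonFace, CutBottom, CutLeft, ne_eq, Prod.mk.injEq] at h1 h2
      simp only [pivotVertex] at h
      simp only [eliminationRank]
      split_ifs at h ⊢ <;> simp only at h <;> omega
    · have h := mem_octagon488.1 hmem'
      have h1 := mem_octagonLabels.1 (by simpa using hp' : (x', y') ∈ octagonLabels s)
      have h2 := mem_octagonLabels.1 (by simpa using hp : (x, y) ∈ octagonLabels s)
      simp only [IsOctagonFace, CutBottom, CutLeft, ne_eq, Prod.mk.injEq] at h1 h2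
      simp only [ne_eq, Sum.inr.injEq, Prod.mk.injEq] at hne'
      simp only [pivotVertex] at h
      simp only [eliminationRank]
      split_ifs at h <;> simp only [octagonsAt, Finset.mem_insert, Finset.mem_singleton,
        Prod.mk.injEq] at h <;> split_ifs <;> omega

theorem encodes488 (s : ℕ) : Encodes (faces488 s) (2 * s ^ 2 + 4 * s + 1) 1 := by
  have h1 : Module.finrank (ZMod 2) (stabilizerSpace (faces488 s)) =
      (triangleCells s).card + ((triangleCells s).card + s) := by
    rw [stabilizerSpace, ← range_faceOf, ← Set.range_comp]
    rw [← card_octagonLabels, ← Finset.card_disjSum, ← Fintype.card_coe]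
    exact finrank_span_eq_card linearIndependent_faceOf
  have h2 := two_mul_card_triangleCells s
  refine ⟨?_, ?_⟩
  · rw [Fintype.card_coe, card_vertices488]
    nlinarith
  · rw [h1]
    nlinarith

theorem isOddSelfDual488 (s : ℕ) : IsOddSelfDual (faces488 s) := by
  refine isOddSelfDual_of_even_overlaps (encodes488 s) ?_ ?_
  · rintro f (⟨a, b, h, rfl⟩ | ⟨p, h1, h2, h3, h4, rfl⟩)
    · exact even_card_square h
    · exact even_card_octagon ⟨h1, h2, h3, h4⟩
  · rintro f (⟨a, b, h, rfl⟩ | ⟨p, h1, h2, h3, h4, rfl⟩) g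
      (⟨a', b', h', rfl⟩ | ⟨p', h1', h2', h3', h4', rfl⟩)
    · by_cases heq : a = a' ∧ b = b'
      · obtain ⟨rfl, rfl⟩ := heq
        rw [Finset.inter_self]
        exact even_card_square h
      · have hdisj : Disjoint (square488 s a b) (square488 s a' b') := by
          rw [Finset.disjoint_left]
          intro q hq hq'
          rw [mem_square488] at hq hq'
          exact heq ⟨hq.1.symm.trans hq'.1, hq.2.symm.trans hq'.2⟩
        simp [Finset.disjoint_iff_inter_eq_empty.1 hdisj]
    · exact even_card_square_inter_octagon h p'
    · rw [Finset.inter_comm]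
      exact even_card_square_inter_octagon h' p
    · by_cases heq : p = p'
      · subst heq
        rw [Finset.inter_self]
        exact even_card_octagon ⟨h1, h2, h3, h4⟩
      · exact even_card_octagon_inter heq ⟨h1, h2, h3, h4⟩ ⟨h1', h2', h3', h4'⟩

end Code488

/-! ### The triangular 4-8-8 codes: boundaries -/

/-- A set `B` is equivalent to the set of all qubits, up to a stabilizer, if the faces of one colour
partition its complement; `label` gives the face of this colour at each qubit, and takes a value
outside `I` on `B`. -/
theorem indicatorVec_add_one_mem {V ι : Type*} {faces : Set (Finset V)} {B : Finset V}
    (I : Finset ι) (F : ι → Finset V) (label : V → ι) (hF : ∀ i ∈ I, F i ∈ faces)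
    (hlabel : ∀ i ∈ I, ∀ v, v ∈ F i ↔ i = label v) (hB : ∀ v, v ∈ B ↔ label v ∉ I) :
    (fun v => indicatorVec B v + 1) ∈ stabilizerSpace faces := by
  classical
  have h1 : (fun v => indicatorVec B v + 1) = ∑ i ∈ I, indicatorVec (F i) := by
    ext v
    rw [Finset.sum_apply]
    have h2 : ∀ i ∈ I, indicatorVec (F i) v = if i = label v then 1 else 0 := by
      intro i hi
      simp [indicatorVec, hlabel i hi v]
    rw [Finset.sum_congr rfl h2, Finset.sum_ite_eq']
    have h3 : (1 + 1 : ZMod 2) = 0 := rfl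
    by_cases h : label v ∈ I <;> simp [indicatorVec, hB, h, h3]
  rw [h1]
  exact Submodule.sum_mem _ fun i hi => Submodule.subset_span ⟨F i, hF i hi, rfl⟩

/-- The qubits of `B` form a path, numbered from `0` to `n` by `index`, such that any two consecutive
ones are all the qubits of `B` on some face. -/
structure IsBoundaryPath {V : Type*} (faces : Set (Finset V)) (B : Finset V) (n : ℕ)
    (index : V → ℕ) : Prop where
  index_le : ∀ v ∈ B, index v ≤ n
  index_injOn : ∀ v ∈ B, ∀ w ∈ B, index v = index w → v = w
  exists_index : ∀ k ≤ n, ∃ v ∈ B, index v = k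
  exists_face : ∀ k < n, ∃ f ∈ faces, ∀ v ∈ B, v ∈ f ↔ index v = k ∨ index v = k + 1

namespace IsBoundaryPath

variable {V : Type*} {faces : Set (Finset V)} {B : Finset V} {n : ℕ} {index : V → ℕ}
  (h : IsBoundaryPath faces B n index)

include h

theorem card_eq : B.card = n + 1 := by
  rw [← Finset.card_range (n + 1)]
  refine Finset.card_bij (fun v _ => index v) ?_ h.index_injOn ?_
  · intro v hv
    exact Finset.mem_range.2 (Nat.lt_succ_of_le (h.index_le v hv))
  · intro k hk
    obtain ⟨v, hv, hvk⟩ := h.exists_index k (Nat.le_of_lt_succ (Finset.mem_range.1 hk))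
    exact ⟨v, hv, hvk⟩

/-- Evenness on the faces along the path makes a vector supported on the path constant there. -/
theorem eq_zero_or_eq_indicatorVec [Fintype V] : ∀ f ∈ commutantSpace faces,
    (∀ v ∉ B, f v = 0) → f = 0 ∨ f = indicatorVec B := by
  classical
  intro f hf hsupp
  obtain ⟨v₀, hv₀, hi₀⟩ := h.exists_index 0 (Nat.zero_le n)
  have hconst : ∀ k, ∀ v ∈ B, index v = k → f v = f v₀ := by
    intro k
    induction k with
    | zero =>
      intro v hv hvk
      rw [h.index_injOn v hv v₀ hv₀ (hvk.trans hi₀.symm)]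
    | succ k ih =>
      intro v hv hvk
      have hkn : k < n := by
        have := h.index_le v hv
        omega
      obtain ⟨w, hw, hwk⟩ := h.exists_index k hkn.le
      obtain ⟨g, hg, hgB⟩ := h.exists_face k hkn
      have hne : w ≠ v := by
        rintro rfl
        omega
      have hsub : ({w, v} : Finset V) ⊆ g := by
        intro x hx
        rcases Finset.mem_insert.1 hx with rfl | hx
        · exact (hgB _ hw).2 (Or.inl hwk)
        · rw [Finset.mem_singleton.1 hx]
          exact (hgB _ hv).2 (Or.inr hvk)
      have hsum := commutes_iff_faces.1 hf g hg
      rw [← Finset.sum_subset hsub, Finset.sum_pair hne, ih w hw hwk] at hsum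
      · have : ∀ x y : ZMod 2, x + y = 0 → y = x := by decide
        exact this _ _ hsum
      · intro x hxg hx
        refine hsupp x fun hxB => hx ?_
        rcases (hgB x hxB).1 hxg with hi | hi
        · rw [h.index_injOn x hxB w hw (hi.trans hwk.symm)]
          simp
        · rw [h.index_injOn x hxB v hv (hi.trans hvk.symm)]
          simp
  rcases zmod_two_cases (f v₀) with h0 | h1
  · left
    ext v
    by_cases hv : v ∈ B
    · rw [hconst _ v hv rfl, h0]
      rfl
    · exact hsupp v hv
  · right
    ext v
    by_cases hv : v ∈ B
    · rw [hconst _ v hv rfl, h1]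
      simp [indicatorVec, hv]
    · rw [hsupp v hv]
      simp [indicatorVec, hv]

end IsBoundaryPath

section Code488

variable {s : ℕ}

/-- The octagon whose coordinate sum has the given parity at a vertex of the tiling. -/
def octagonOfParity (r : ℕ) : ℕ × ℕ × Corner → ℕ × ℕ
  | (a, b, Corner.west) => if (a + b) % 2 = r then (a, b) else (a, b + 1)
  | (a, b, Corner.south) => if (a + b) % 2 = r then (a, b) else (a + 1, b)
  | (a, b, Corner.east) => if (a + b) % 2 = r then (a + 1, b + 1) else (a + 1, b)
  | (a, b, Corner.north) => if (a + b) % 2 = r then (a + 1, b + 1) else (a, b + 1)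

theorem mem_octagonsAt_iff {r : ℕ} (hr : r < 2) {p : ℕ × ℕ} (hp : (p.1 + p.2) % 2 = r)
    (q : ℕ × ℕ × Corner) : p ∈ octagonsAt q ↔ p = octagonOfParity r q := by
  obtain ⟨x, y⟩ := p
  obtain ⟨a, b, c⟩ := q
  simp only at hp
  cases c <;> simp only [octagonsAt, octagonOfParity, Finset.mem_insert, Finset.mem_singleton,
    Prod.mk.injEq] <;> split_ifs <;> simp only [Prod.mk.injEq] <;> omega

theorem octagonOfParity_parity {r : ℕ} (hr : r < 2) (q : ℕ × ℕ × Corner) :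
    ((octagonOfParity r q).1 + (octagonOfParity r q).2) % 2 = r := by
  obtain ⟨a, b, c⟩ := q
  cases c <;> simp only [octagonOfParity] <;> split_ifs <;> simp only <;> omega

theorem add_le_of_mem_octagonsAt {q : ℕ × ℕ × Corner} (hq : q ∈ vertices488 s) {p : ℕ × ℕ}
    (hp : p ∈ octagonsAt q) : p.1 + p.2 ≤ s + 1 ∧ p ≠ (s + 1, 0) := by
  obtain ⟨x, y⟩ := p
  obtain ⟨a, b, c⟩ := q
  rw [mem_vertices488] at hq
  cases c <;> simp only [octagonsAt, Finset.mem_insert, Finset.mem_singleton, ne_eq,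
    Prod.mk.injEq, reduceCtorEq, true_and, false_and, or_false, and_false, false_or] at hp hq ⊢ <;>
    omega

theorem mem_boundary488_zero {q : Qubit488 s} :
    q ∈ boundary488 s 0 ↔ ∃ p ∈ octagonsAt q.1, CutBottom s p := by
  simp [boundary488]

theorem mem_boundary488_one {q : Qubit488 s} :
    q ∈ boundary488 s 1 ↔ ∃ p ∈ octagonsAt q.1, CutLeft s p := by
  simp [boundary488]

theorem mem_boundary488_two {q : Qubit488 s} :
    q ∈ boundary488 s 2 ↔ q.1.1 + q.1.2.1 = s := by
  simp [boundary488]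

open Classical in
/-- The complement of a boundary is partitioned by the faces of one colour: the octagons of either
parity for the bottom and the left boundary, and the squares for the diagonal one. -/
theorem boundary488_add_one_mem (i : Fin 3) :
    (fun v => indicatorVec (boundary488 s i) v + 1) ∈ stabilizerSpace (faces488 s) := by
  fin_cases i
  · have hr : s % 2 < 2 := Nat.mod_lt _ two_pos
    refine indicatorVec_add_one_mem ((octagonLabels s).filter fun p => (p.1 + p.2) % 2 = s % 2)
      (octagon488 s) (fun q => octagonOfParity (s % 2) q.1) ?_ ?_ ?_
    · intro p hp
      obtain ⟨h1, h2, h3, h4⟩ := mem_octagonLabels.1 (Finset.mem_filter.1 hp).1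
      exact Or.inr ⟨p, h1, h2, h3, h4, rfl⟩
    · intro p hp q
      rw [mem_octagon488, mem_octagonsAt_iff hr (Finset.mem_filter.1 hp).2]
    · intro q
      have h1 := octagonOfParity_parity hr q.1
      have h2 := (mem_octagonsAt_iff hr h1 q.1).2 rfl
      obtain ⟨h3, h4⟩ := add_le_of_mem_octagonsAt q.2 h2
      simp only [Fin.zero_eta, mem_boundary488_zero, Finset.mem_filter, mem_octagonLabels, h1,
        and_true, IsOctagonFace, not_and, not_not]
      constructor
      · rintro ⟨p, hp, hcut⟩ _ _ h5
        rw [(mem_octagonsAt_iff hr hcut.2 q.1).1 hp] at hcut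
        exact absurd hcut h5
      · intro h5
        by_contra hcon
        exact (h5 h3 h4 fun hcut => hcon ⟨_, h2, hcut⟩).2 h1
  · have hr : (s + 1) % 2 < 2 := Nat.mod_lt _ two_pos
    refine indicatorVec_add_one_mem
      ((octagonLabels s).filter fun p => (p.1 + p.2) % 2 = (s + 1) % 2)
      (octagon488 s) (fun q => octagonOfParity ((s + 1) % 2) q.1) ?_ ?_ ?_
    · intro p hp
      obtain ⟨h1, h2, h3, h4⟩ := mem_octagonLabels.1 (Finset.mem_filter.1 hp).1
      exact Or.inr ⟨p, h1, h2, h3, h4, rfl⟩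
    · intro p hp q
      rw [mem_octagon488, mem_octagonsAt_iff hr (Finset.mem_filter.1 hp).2]
    · intro q
      have h1 := octagonOfParity_parity hr q.1
      have h2 := (mem_octagonsAt_iff hr h1 q.1).2 rfl
      obtain ⟨h3, h4⟩ := add_le_of_mem_octagonsAt q.2 h2
      simp only [Fin.mk_one, mem_boundary488_one, Finset.mem_filter, mem_octagonLabels, h1,
        and_true, IsOctagonFace, not_and, not_not]
      constructor
      · rintro ⟨p, hp, hcut⟩ _ _ _
        have hp1 : (p.1 + p.2) % 2 = (s + 1) % 2 := by
          have := hcut.2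
          omega
        rw [(mem_octagonsAt_iff hr hp1 q.1).1 hp] at hcut
        exact hcut
      · intro h5
        refine ⟨_, h2, h5 h3 h4 fun hcut => ?_⟩
        have := hcut.2
        omega
  · refine indicatorVec_add_one_mem (triangleCells s) (fun p => square488 s p.1 p.2)
      (fun q => (q.1.1, q.1.2.1)) ?_ ?_ ?_
    · intro p hp
      exact Or.inl ⟨p.1, p.2, mem_triangleCells.1 hp, rfl⟩
    · rintro ⟨a, b⟩ _ q
      rw [mem_square488, Prod.mk.injEq, eq_comm, eq_comm (a := b)]
    · rintro ⟨⟨a, b, c⟩, hq⟩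
      have := mem_vertices488.1 hq
      simp only [Fin.reduceFinMk, mem_boundary488_two, mem_triangleCells]
      omega

/-- The numbering of the bottom boundary from the left to the right. -/
def indexBottom (s : ℕ) : ℕ × ℕ × Corner → ℕ
  | (a, _, Corner.west) => 2 * a
  | (a, _, Corner.south) => if a % 2 = s % 2 then 2 * a + 1 else 2 * a
  | (a, _, Corner.east) => 2 * a + 1
  | (_, _, Corner.north) => 0

/-- The numbering of the left boundary from below upwards. -/
def indexLeft (s : ℕ) : ℕ × ℕ × Corner → ℕ
  | (_, b, Corner.west) => if b % 2 = s % 2 then 2 * b else 2 * b + 1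
  | (_, b, Corner.south) => 2 * b
  | (_, b, Corner.north) => 2 * b + 1
  | (_, _, Corner.east) => 0

/-- The numbering of the diagonal boundary from the left to the right. -/
def indexDiagonal : ℕ × ℕ × Corner → ℕ
  | (a, _, Corner.west) => 2 * a
  | (a, _, _) => 2 * a + 1

theorem mem_bottom_iff {a b : ℕ} {c : Corner} (hq : (a, b, c) ∈ vertices488 s) :
    (⟨(a, b, c), hq⟩ : Qubit488 s) ∈ boundary488 s 0 ↔ b = 0 ∧
      (c = Corner.west ∧ a % 2 = s % 2 ∨ c = Corner.south ∨ c = Corner.east ∧ a % 2 ≠ s % 2) := by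
  rw [mem_boundary488_zero]
  cases c <;> simp [octagonsAt, CutBottom] <;> omega

theorem mem_left_iff {a b : ℕ} {c : Corner} (hq : (a, b, c) ∈ vertices488 s) :
    (⟨(a, b, c), hq⟩ : Qubit488 s) ∈ boundary488 s 1 ↔ a = 0 ∧
      (c = Corner.south ∧ b % 2 ≠ s % 2 ∨ c = Corner.west ∨ c = Corner.north ∧ b % 2 = s % 2) := by
  rw [mem_boundary488_one]
  cases c <;> simp [octagonsAt, CutLeft] <;> omega

theorem isBoundaryPath_bottom (s : ℕ) :
    IsBoundaryPath (faces488 s) (boundary488 s 0) (2 * s) fun q => indexBottom s q.1 := by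
  constructor
  · rintro ⟨⟨a, b, c⟩, hq⟩ hv
    rw [mem_bottom_iff] at hv
    rw [mem_vertices488] at hq
    cases c <;> simp [indexBottom] at hv hq ⊢ <;> (try split_ifs) <;> omega
  · rintro ⟨⟨a, b, c⟩, hq⟩ hv ⟨⟨a', b', c'⟩, hq'⟩ hw h
    rw [mem_bottom_iff] at hv hw
    cases c <;> cases c' <;> simp [indexBottom] at hv hw h ⊢ <;> (try split_ifs at h) <;> omega
  · intro k hk
    have key : ∀ c, (k / 2, 0, c) ∈ vertices488 s → (c = Corner.west ∧ k / 2 % 2 = s % 2 ∨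
        c = Corner.south ∨ c = Corner.east ∧ k / 2 % 2 ≠ s % 2) →
        indexBottom s (k / 2, 0, c) = k →
          ∃ v ∈ boundary488 s 0, indexBottom s v.1 = k := fun c hq hc hi =>
      ⟨⟨(k / 2, 0, c), hq⟩, (mem_bottom_iff hq).2 ⟨rfl, hc⟩, hi⟩
    by_cases hpar : k / 2 % 2 = s % 2 <;> by_cases hk2 : k % 2 = 0
    · refine key Corner.west ?_ ?_ ?_ <;> simp [mem_vertices488, indexBottom, hpar] <;> omega
    · refine key Corner.south ?_ ?_ ?_ <;> simp [mem_vertices488, indexBottom, hpar] <;> omega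
    · refine key Corner.south ?_ ?_ ?_ <;> simp [mem_vertices488, indexBottom, hpar] <;> omega
    · refine key Corner.east ?_ ?_ ?_ <;> simp [mem_vertices488, indexBottom, hpar] <;> omega
  · intro k hk
    by_cases hk2 : k % 2 = 0
    · refine ⟨square488 s (k / 2) 0, Or.inl ⟨_, _, by omega, rfl⟩, ?_⟩
      rintro ⟨⟨a, b, c⟩, hq⟩ hv
      rw [mem_bottom_iff] at hv
      rw [mem_square488]
      cases c <;> simp [indexBottom] at hv ⊢ <;> (try split_ifs) <;> omega
    · by_cases hpar : k / 2 % 2 = s % 2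
      · refine ⟨octagon488 s (k / 2 + 1, 0), Or.inr ⟨_, ?_, ?_, ?_, ?_, rfl⟩, ?_⟩
        · simp only; omega
        · simp only [ne_eq, Prod.mk.injEq]; omega
        · simp only [CutBottom]; omega
        · simp [CutLeft]
        · rintro ⟨⟨a, b, c⟩, hq⟩ hv
          rw [mem_bottom_iff] at hv
          rw [mem_octagon488]
          cases c <;> simp [indexBottom, octagonsAt] at hv ⊢ <;> (try split_ifs) <;> omega
      · refine ⟨octagon488 s (k / 2 + 1, 1), Or.inr ⟨_, ?_, ?_, ?_, ?_, rfl⟩, ?_⟩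
        · simp only; omega
        · simp
        · simp [CutBottom]
        · simp [CutLeft]
        · rintro ⟨⟨a, b, c⟩, hq⟩ hv
          rw [mem_bottom_iff] at hv
          rw [mem_octagon488]
          cases c <;> simp [indexBottom, octagonsAt] at hv ⊢ <;> (try split_ifs) <;> omega

theorem isBoundaryPath_left (s : ℕ) :
    IsBoundaryPath (faces488 s) (boundary488 s 1) (2 * s) fun q => indexLeft s q.1 := by
  constructor
  · rintro ⟨⟨a, b, c⟩, hq⟩ hv
    rw [mem_left_iff] at hv
    rw [mem_vertices488] at hq
    cases c <;> simp [indexLeft] at hv hq ⊢ <;> (try split_ifs) <;> omega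
  · rintro ⟨⟨a, b, c⟩, hq⟩ hv ⟨⟨a', b', c'⟩, hq'⟩ hw h
    rw [mem_left_iff] at hv hw
    cases c <;> cases c' <;> simp [indexLeft] at hv hw h ⊢ <;> (try split_ifs at h) <;> omega
  · intro k hk
    have key : ∀ c, (0, k / 2, c) ∈ vertices488 s → (c = Corner.south ∧ k / 2 % 2 ≠ s % 2 ∨
        c = Corner.west ∨ c = Corner.north ∧ k / 2 % 2 = s % 2) →
        indexLeft s (0, k / 2, c) = k →
          ∃ v ∈ boundary488 s 1, indexLeft s v.1 = k := fun c hq hc hi =>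
      ⟨⟨(0, k / 2, c), hq⟩, (mem_left_iff hq).2 ⟨rfl, hc⟩, hi⟩
    by_cases hpar : k / 2 % 2 = s % 2 <;> by_cases hk2 : k % 2 = 0
    · refine key Corner.west ?_ ?_ ?_ <;> simp [mem_vertices488, indexLeft, hpar] <;> omega
    · refine key Corner.north ?_ ?_ ?_ <;> simp [mem_vertices488, indexLeft, hpar] <;> omega
    · refine key Corner.south ?_ ?_ ?_ <;> simp [mem_vertices488, indexLeft, hpar] <;> omega
    · refine key Corner.west ?_ ?_ ?_ <;> simp [mem_vertices488, indexLeft, hpar] <;> omega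
  · intro k hk
    by_cases hk2 : k % 2 = 0
    · refine ⟨square488 s 0 (k / 2), Or.inl ⟨_, _, by omega, rfl⟩, ?_⟩
      rintro ⟨⟨a, b, c⟩, hq⟩ hv
      rw [mem_left_iff] at hv
      rw [mem_square488]
      cases c <;> simp [indexLeft] at hv ⊢ <;> (try split_ifs) <;> omega
    · by_cases hpar : k / 2 % 2 = s % 2
      · refine ⟨octagon488 s (1, k / 2 + 1), Or.inr ⟨_, ?_, ?_, ?_, ?_, rfl⟩, ?_⟩
        · simp only; omega
        · simp
        · simp [CutBottom]
        · simp [CutLeft]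
        · rintro ⟨⟨a, b, c⟩, hq⟩ hv
          rw [mem_left_iff] at hv
          rw [mem_octagon488]
          cases c <;> simp [indexLeft, octagonsAt] at hv ⊢ <;> (try split_ifs) <;> omega
      · refine ⟨octagon488 s (0, k / 2 + 1), Or.inr ⟨_, ?_, ?_, ?_, ?_, rfl⟩, ?_⟩
        · simp only; omega
        · simp
        · simp [CutBottom]
        · simp only [CutLeft]; omega
        · rintro ⟨⟨a, b, c⟩, hq⟩ hv
          rw [mem_left_iff] at hv
          rw [mem_octagon488]
          cases c <;> simp [indexLeft, octagonsAt] at hv ⊢ <;> (try split_ifs) <;> omega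

theorem isBoundaryPath_diagonal (s : ℕ) :
    IsBoundaryPath (faces488 s) (boundary488 s 2) (2 * s) fun q => indexDiagonal q.1 := by
  constructor
  · rintro ⟨⟨a, b, c⟩, hq⟩ hv
    rw [mem_boundary488_two] at hv
    rw [mem_vertices488] at hq
    cases c <;> simp [indexDiagonal] at hv hq ⊢ <;> omega
  · rintro ⟨⟨a, b, c⟩, hq⟩ hv ⟨⟨a', b', c'⟩, hq'⟩ hw h
    rw [mem_boundary488_two] at hv hw
    rw [mem_vertices488] at hq hq'
    cases c <;> cases c' <;> simp [indexDiagonal] at hv hw hq hq' h ⊢ <;> omega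
  · intro k hk
    have key : ∀ c, (k / 2, s - k / 2, c) ∈ vertices488 s →
        indexDiagonal (k / 2, s - k / 2, c) = k →
          ∃ v ∈ boundary488 s 2, indexDiagonal v.1 = k := fun c hq hi =>
      ⟨⟨(k / 2, s - k / 2, c), hq⟩, mem_boundary488_two.2 (by simp only; omega), hi⟩
    by_cases hk2 : k % 2 = 0
    · refine key Corner.west ?_ ?_ <;> simp [mem_vertices488, indexDiagonal] <;> omega
    · refine key Corner.south ?_ ?_ <;> simp [mem_vertices488, indexDiagonal] <;> omega
  · intro k hk
    by_cases hk2 : k % 2 = 0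
    · refine ⟨octagon488 s (k / 2, s - k / 2), Or.inr ⟨_, ?_, ?_, ?_, ?_, rfl⟩, ?_⟩
      · simp only; omega
      · simp only [ne_eq, Prod.mk.injEq]; omega
      · simp only [CutBottom]; omega
      · simp only [CutLeft]; omega
      · rintro ⟨⟨a, b, c⟩, hq⟩ hv
        rw [mem_boundary488_two] at hv
        rw [mem_octagon488]
        rw [mem_vertices488] at hq
        cases c <;> simp [indexDiagonal, octagonsAt] at hv hq ⊢ <;> omega
    · refine ⟨octagon488 s (k / 2 + 1, s - k / 2), Or.inr ⟨_, ?_, ?_, ?_, ?_, rfl⟩, ?_⟩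
      · simp only; omega
      · simp only [ne_eq, Prod.mk.injEq]; omega
      · simp only [CutBottom]; omega
      · simp [CutLeft]
      · rintro ⟨⟨a, b, c⟩, hq⟩ hv
        rw [mem_boundary488_two] at hv
        rw [mem_octagon488]
        rw [mem_vertices488] at hq
        cases c <;> simp [indexDiagonal, octagonsAt] at hv hq ⊢ <;> omega

theorem exists_isBoundaryPath (s : ℕ) (i : Fin 3) :
    ∃ index, IsBoundaryPath (faces488 s) (boundary488 s i) (2 * s) index := by
  fin_cases i
  · exact ⟨_, isBoundaryPath_bottom s⟩
  · exact ⟨_, isBoundaryPath_left s⟩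
  · exact ⟨_, isBoundaryPath_diagonal s⟩

theorem card_boundary488 (s : ℕ) (i : Fin 3) : (boundary488 s i).card = 2 * s + 1 := by
  obtain ⟨_, h⟩ := exists_isBoundaryPath s i
  exact h.card_eq

theorem efficiency_boundary488 (s : ℕ) (i : Fin 3) :
    efficiency (faces488 s) (boundaryFormation (boundary488 s i)) =
      1 - (1 / 2 : ℝ) ^ (2 * s + 1) := by
  obtain ⟨_, h⟩ := exists_isBoundaryPath s i
  have hcode := isOddSelfDual488 s
  obtain ⟨hmem, hsum⟩ :=
    (hcode.add_mem_stabilizerSpace_iff _ 1).1 (boundary488_add_one_mem (s := s) i)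
  rw [hcode.efficiency_boundaryFormation hmem hsum h.eq_zero_or_eq_indicatorVec,
    card_boundary488]

end Code488

theorem theorem5 :
    (∀ (W : Type*) [Fintype W] [DecidableEq W] (T : TriangularCellulation W) (N d : ℕ),
      Encodes T.faces N 1 → IsDistance T.faces d →
        (∀ i : Fin 3, (T.boundary i).card = d →
          efficiency T.faces (boundaryFormation (T.boundary i)) = 1 - (1 / 2 : ℝ) ^ d) ∧
        (∀ m : BellMeasurement, efficiency T.faces (fun _ => m) ≤ 1 / 2)) ∧
    (∀ s : ℕ, 1 ≤ s →
      Encodes (faces488 s) (2 * s ^ 2 + 4 * s + 1) 1 ∧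
        (∀ i : Fin 3, (boundary488 s i).card = 2 * s + 1 ∧
          efficiency (faces488 s) (boundaryFormation (boundary488 s i))
            = 1 - (1 / 2 : ℝ) ^ (2 * s + 1)) ∧
        (∀ m : BellMeasurement, efficiency (faces488 s) (fun _ => m) ≤ 1 / 2)) ∧
    (∀ i : Fin 3, Filter.Tendsto
      (fun s => efficiency (faces488 s) (boundaryFormation (boundary488 s i)))
      Filter.atTop (𝓝 1)) := by
  refine ⟨fun W _ _ T N d henc hd => ⟨fun i hi => T.efficiency_boundary henc hd i hi,
    fun m => (T.isOddSelfDual henc).efficiency_uniform_le m⟩, fun s _ => ⟨encodes488 s,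
      fun i => ⟨card_boundary488 s i, efficiency_boundary488 s i⟩,
      fun m => (isOddSelfDual488 s).efficiency_uniform_le m⟩, fun i => ?_⟩
  simp only [efficiency_boundary488]
  have h1 : Filter.Tendsto (fun s : ℕ => 2 * s + 1) Filter.atTop Filter.atTop :=
    Filter.tendsto_atTop_mono (fun s => by simp only [id]; omega) Filter.tendsto_id
  have h2 := (tendsto_pow_atTop_nhds_zero_of_lt_one (by norm_num : (0 : ℝ) ≤ 1 / 2)
    (by norm_num)).comp h1
  simpa using h2.const_sub 1
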